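/- Let $M$ be a smooth manifold (finite-dimensional, Hausdorff, second countable, without boundary) and let $\{\cdot,\cdot\}$ be a Poisson bracket on $C^\infty(M)$; write $X_f=\{f,\cdot\}$ for the Hamiltonian vector field of $f$. Suppose that the Poisson structure $\pi$ is regular of rank $2n$, that is, at every point of $M$ the values of the Hamiltonian vector fields form a subspace of dimension $2n$ of the tangent space; these subspaces are the tangent spaces of the characteristic foliation $\mathcal F_\pi$. Let $(\Omega^\bullet(\mathcal F_\pi),d_{\mathcal F_\pi})$ be the complex of leafwise differential forms with the leafwise de Rham differential, $H^\bullet(\mathcal F_\pi)$ its cohomology, and $\omega\in\Omega^2(\mathcal F_\pi)$ the leafwise symplectic form, given by $\omega(X_f,X_g)=\{f,g\}$. Let $\{C^\infty(M),C^\infty(M)\}$ be the linear span of all brackets $\{f,g\}$, let $H_0^\pi(M)=C^\infty(M)/\{C^\infty(M),C^\infty(M)\}$ be the zeroth Poisson homology, and let $$\phi\colon C^\infty(M)\to\Omega^{2n}(\mathcal F_\pi),\qquad \phi(f)=f\,\frac{\omega^n}{n!}.$$ Then $$\phi\bigl(\{C^\infty(M),C^\infty(M)\}\bigr)=d_{\mathcal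 F_\pi}\bigl(\Omega^{2n-1}(\mathcal F_\pi)\bigr)$$ (the right side is $0$ if $n=0$), every $\phi(f)$ is leafwise closed, and $[f]\mapsto[\phi(f)]$ is a well-defined isomorphism of real vector spaces $$H_0^\pi(M)\longrightarrow H^{2n}(\mathcal F_\pi).$$ -/

import Mathlib

set_option maxSynthPendingDepth 3
open scoped Manifold ContDiff

namespace LieRinehartAlgebra

variable {A L : Type*} [CommRing A] [LieRing L] [Module A L]

variable (A L) in
/-- The cochains of degree `k` of a Lie-Rinehart algebra `L` over `A`, with values in `A`:
alternating `A`-multilinear maps from `k` copies of `L` to `A`. -/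
abbrev Cochain (k : ℕ) : Type _ :=
  L [⋀^Fin k]→ₗ[A] A

theorem removeNth_update_succAbove {k : ℕ} {B : Type*} (X : Fin (k + 1) → B) (j : Fin (k + 1))
    (i : Fin k) (Z : B) : j.removeNth (Function.update X (j.succAbove i) Z) =
      Function.update (j.removeNth X) i Z := by
  funext s
  simp [Fin.removeNth, Function.update_apply]

theorem koszul_bracket_symm {k : ℕ} (α : Cochain A L k) (X : Fin (k + 1) → L)
    {i j : Fin (k + 1)} (hij : i ≠ j) :
    (-1) ^ (i : ℕ) * α (i.removeNth (Function.update X j ⁅X i, X j⁆)) =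
      (-1) ^ (j : ℕ) * α (j.removeNth (Function.update X i ⁅X j, X i⁆)) := by
  have h := AlternatingMap.neg_one_pow_smul_map_removeNth_add_eq_zero_of_eq α
    (v := Function.update (Function.update X j ⁅X i, X j⁆) i ⁅X i, X j⁆) (i := i) (j := j)
    (by simp [hij.symm]) hij
  rw [Fin.removeNth_update, Function.update_comm hij.symm, Fin.removeNth_update] at h
  have h2 : α (j.removeNth (Function.update X i ⁅X j, X i⁆)) =
      - α (j.removeNth (Function.update X i ⁅X i, X j⁆)) := by
    obtain ⟨i', rfl⟩ := Fin.exists_succAbove_eq hij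
    rw [← lie_skew]
    rw [removeNth_update_succAbove, removeNth_update_succAbove, AlternatingMap.map_update_neg]
  rw [h2]
  simp only [zsmul_eq_mul, Int.cast_pow, Int.cast_neg, Int.cast_one] at h
  linear_combination h

theorem map_removeNth_update_smul {k : ℕ} (α : Cochain A L k) (X : Fin (k + 1) → L)
    {i j : Fin (k + 1)} (h : j ≠ i) (g : A) (Y : L) :
    α (i.removeNth (Function.update X j (g • Y))) =
      g * α (i.removeNth (Function.update X j Y)) := by
  obtain ⟨j', rfl⟩ := Fin.exists_succAbove_eq h
  rw [removeNth_update_succAbove, removeNth_update_succAbove, AlternatingMap.map_update_smul,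
    smul_eq_mul]

variable [LieRingModule L A] [LieRinehartRing A L]

/-- The Koszul formula for the differential of a `k`-cochain,
`∑ i, (-1)^i Xᵢ(α(…, X̂ᵢ, …)) + ∑ i < j, (-1)^(i+j) α([Xᵢ, Xⱼ], …, X̂ᵢ, …, X̂ⱼ, …)`.
In the second sum the bracket `[Xᵢ, Xⱼ]` is written in the place of `Xⱼ` instead of in front,
which turns the sign `(-1)^(i+j)` into `-(-1)^i`. -/
def koszul {k : ℕ} (α : Cochain A L k) (X : Fin (k + 1) → L) : A :=
  ∑ i : Fin (k + 1), (-1) ^ (i : ℕ) *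
    (⁅X i, α (i.removeNth X)⁆ -
      ∑ j ∈ Finset.Ioi i, α (i.removeNth (Function.update X j ⁅X i, X j⁆)))

theorem koszul_update_zero_smul {k : ℕ} (α : Cochain A L k) (X : Fin (k + 1) → L) (g : A) (Y : L) :
    koszul α (Function.update X 0 (g • Y)) = g * koszul α (Function.update X 0 Y) := by
  have hfirst : ∀ Z (s : Fin k) V, (0 : Fin (k + 1)).removeNth
      (Function.update (Function.update X 0 Z) s.succ V) =
      Function.update ((0 : Fin (k + 1)).removeNth X) s V := by
    intro Z s V
    rw [← Fin.zero_succAbove s, removeNth_update_succAbove, Fin.removeNth_update]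
  have hbr : ∀ s : Fin k, ⁅g • Y, X s.succ⁆ = g • ⁅Y, X s.succ⁆ + (-⁅X s.succ, g⁆) • Y := by
    intro s
    rw [← lie_skew, LieRinehartRing.leibniz_smul_right, ← lie_skew Y, neg_add, neg_smul, smul_neg]
  have hmove : ∀ s : Fin k, (-1) ^ ((s.succ : Fin (k + 1)) : ℕ) *
      α (s.succ.removeNth (Function.update X 0 Y)) =
      - α (Function.update ((0 : Fin (k + 1)).removeNth X) s Y) := by
    intro s
    have h := AlternatingMap.neg_one_pow_smul_map_removeNth_add_eq_zero_of_eq α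
      (v := Function.update (Function.update X 0 Y) s.succ Y) (i := 0) (j := s.succ)
      (by rw [Function.update_self, Function.update_of_ne (Fin.succ_ne_zero s).symm,
        Function.update_self]) (Fin.succ_ne_zero s).symm
    rw [Fin.removeNth_update] at h
    rw [show (0 : Fin (k + 1)).removeNth (Function.update (Function.update X 0 Y) s.succ Y) =
      Function.update ((0 : Fin (k + 1)).removeNth X) s Y by
        rw [hfirst]] at h
    simp only [zsmul_eq_mul, Int.cast_pow, Int.cast_neg, Int.cast_one, Fin.val_zero, pow_zero,
      one_mul] at h
    linear_combination h
  simp only [koszul, Fin.sum_univ_succ, Function.update_self, Fin.sum_Ioi_zero, Fin.val_zero,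
    pow_zero, one_mul, Fin.removeNth_update, Function.update_of_ne (Fin.succ_ne_zero _), hfirst,
    hbr, AlternatingMap.map_update_add, AlternatingMap.map_update_smul, smul_eq_mul,
    LieRinehartRing.lie_smul_eq_mul]
  have hs : ∀ s : Fin k, (-1) ^ ((s.succ : Fin (k + 1)) : ℕ) *
      (⁅X s.succ, α (s.succ.removeNth (Function.update X 0 (g • Y)))⁆ -
        ∑ j ∈ Finset.Ioi s.succ, α (s.succ.removeNth
          (Function.update (Function.update X 0 (g • Y)) j
            ⁅X s.succ, Function.update X 0 (g • Y) j⁆))) =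
      g * ((-1) ^ ((s.succ : Fin (k + 1)) : ℕ) *
      (⁅X s.succ, α (s.succ.removeNth (Function.update X 0 Y))⁆ -
        ∑ j ∈ Finset.Ioi s.succ, α (s.succ.removeNth
          (Function.update (Function.update X 0 Y) j
            ⁅X s.succ, Function.update X 0 Y j⁆)))) -
      ⁅X s.succ, g⁆ * α (Function.update ((0 : Fin (k + 1)).removeNth X) s Y) := by
    intro s
    have hsum : ∑ j ∈ Finset.Ioi s.succ, α (s.succ.removeNth
          (Function.update (Function.update X 0 (g • Y)) j
            ⁅X s.succ, Function.update X 0 (g • Y) j⁆)) =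
        g * ∑ j ∈ Finset.Ioi s.succ, α (s.succ.removeNth
          (Function.update (Function.update X 0 Y) j
            ⁅X s.succ, Function.update X 0 Y j⁆)) := by
      rw [Finset.mul_sum]
      refine Finset.sum_congr rfl fun j hj => ?_
      have hj0 : j ≠ 0 := (lt_of_le_of_lt (Fin.zero_le _) (Finset.mem_Ioi.1 hj)).ne'
      rw [Function.update_of_ne hj0, Function.update_of_ne hj0, Function.update_comm hj0.symm,
        Function.update_comm hj0.symm,
        map_removeNth_update_smul _ _ (Fin.succ_ne_zero s).symm]
    rw [hsum, map_removeNth_update_smul _ _ (Fin.succ_ne_zero s).symm,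
      LieRinehartRing.leibniz_mul_right, smul_eq_mul]
    linear_combination ⁅X s.succ, g⁆ * hmove s
  rw [Finset.sum_congr rfl fun s _ => hs s]
  simp only [Finset.sum_add_distrib, Finset.sum_sub_distrib, mul_add, mul_sub, ← Finset.mul_sum,
    neg_mul, Finset.sum_neg_distrib]
  ring

variable [Algebra ℝ A] [LieAlgebra ℝ L] [LieRinehartAlgebra ℝ A L]

/-- Auxiliary: the alternating form `2 Y(α(v)) - ∑ s, α(…, [Y, vₛ], …)`, used only to show that the
Koszul formula is additive and alternating. -/
noncomputable def lieAux {k : ℕ} (α : Cochain A L k) (Y : L) : L [⋀^Fin k]→ₗ[ℝ] A where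
  toFun v := 2 * ⁅Y, α v⁆ - ∑ s, α (Function.update v s ⁅Y, v s⁆)
  map_update_add' := by
    intro inst v i x y
    obtain rfl : inst = instDecidableEqFin k := Subsingleton.elim _ _
    have e : ∀ z, ∑ s, α (Function.update (Function.update v i z) s ⁅Y, Function.update v i z s⁆)
        = α (Function.update v i ⁅Y, z⁆) +
          ∑ s ∈ Finset.univ.erase i, α (Function.update (Function.update v s ⁅Y, v s⁆) i z) := by
      intro z
      rw [← Finset.add_sum_erase _ _ (Finset.mem_univ i)]
      congr 1
      · simp
      · refine Finset.sum_congr rfl fun s hs => ?_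
        have hs := Finset.ne_of_mem_erase hs
        rw [Function.update_of_ne hs, Function.update_comm hs.symm]
    simp only [e, lie_add, AlternatingMap.map_update_add, Finset.sum_add_distrib]
    ring
  map_update_smul' := by
    intro inst v i c x
    obtain rfl : inst = instDecidableEqFin k := Subsingleton.elim _ _
    have e : ∀ z, ∑ s, α (Function.update (Function.update v i z) s ⁅Y, Function.update v i z s⁆)
        = α (Function.update v i ⁅Y, z⁆) +
          ∑ s ∈ Finset.univ.erase i, α (Function.update (Function.update v s ⁅Y, v s⁆) i z) := by
      intro z
      rw [← Finset.add_sum_erase _ _ (Finset.mem_univ i)]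
      congr 1
      · simp
      · refine Finset.sum_congr rfl fun s hs => ?_
        have hs := Finset.ne_of_mem_erase hs
        rw [Function.update_of_ne hs, Function.update_comm hs.symm]
    have hsm : ∀ (w : Fin k → L) (z : L), α (Function.update w i (c • z)) =
        c • α (Function.update w i z) := by
      intro w z
      rw [← algebraMap_smul A c z, AlternatingMap.map_update_smul, algebraMap_smul]
    simp only [e, lie_smul, hsm]
    rw [← Finset.smul_sum, ← smul_add, smul_sub, mul_smul_comm]
  map_eq_zero_of_eq' := by
    intro v a b hab hne
    have h0 : ∀ s, s ≠ a → s ≠ b → α (Function.update v s ⁅Y, v s⁆) = 0 := fun s hsa hsb =>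
      α.map_eq_zero_of_eq _ (i := a) (j := b)
        (by rw [Function.update_of_ne hsa.symm, Function.update_of_ne hsb.symm, hab]) hne
    have hs : ∑ s, α (Function.update v s ⁅Y, v s⁆) =
        α (Function.update v a ⁅Y, v a⁆) + α (Function.update v b ⁅Y, v b⁆) :=
      Fintype.sum_eq_add _ _ hne fun s hs => h0 s hs.1 hs.2
    have hswap := α.map_swap (Function.update v a ⁅Y, v a⁆) hne
    have : (Function.update v a ⁅Y, v a⁆ ∘ Equiv.swap a b) = Function.update v b ⁅Y, v b⁆ := by
      funext s
      by_cases h1 : s = a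
      · subst h1; simp [hne, hne.symm, hab]
      · by_cases h2 : s = b
        · subst h2; simp [hab]
        · simp [Equiv.swap_apply_of_ne_of_ne h1 h2, h1, h2]
    rw [this] at hswap
    rw [hs, hswap, α.map_eq_zero_of_eq v hab hne]
    simp

/-- Auxiliary: `lieAux` as a linear map in the vector field. -/
noncomputable def lieAuxₗ {k : ℕ} (α : Cochain A L k) : L →ₗ[ℝ] L [⋀^Fin k]→ₗ[ℝ] A where
  toFun := lieAux α
  map_add' Y Z := by
    ext v
    simp only [lieAux, AlternatingMap.coe_mk, MultilinearMap.coe_mk, AlternatingMap.add_apply,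
      add_lie, AlternatingMap.map_update_add, Finset.sum_add_distrib]
    ring
  map_smul' c Y := by
    ext v
    have hsm : ∀ (i : Fin k) (z : L), α (Function.update v i (c • z)) =
        c • α (Function.update v i z) := by
      intro i z
      rw [← algebraMap_smul A c z, AlternatingMap.map_update_smul, algebraMap_smul]
    simp only [lieAux, AlternatingMap.coe_mk, MultilinearMap.coe_mk, AlternatingMap.smul_apply,
      smul_lie, hsm, RingHom.id_apply]
    rw [← Finset.smul_sum, smul_sub, mul_smul_comm]

theorem two_mul_koszul {k : ℕ} (α : Cochain A L k) (X : Fin (k + 1) → L) :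
    2 * koszul α X = AlternatingMap.alternatizeUncurryFin (lieAuxₗ α) X := by
  set S : Fin (k + 1) → Fin (k + 1) → A := fun i j =>
    (-1) ^ (i : ℕ) * α (i.removeNth (Function.update X j ⁅X i, X j⁆)) with hS
  have hinner : ∀ i : Fin (k + 1),
      ∑ s, (-1) ^ (i : ℕ) * α (Function.update (i.removeNth X) s ⁅X i, i.removeNth X s⁆) =
        ∑ j ∈ Finset.Iio i, S i j + ∑ j ∈ Finset.Ioi i, S i j := by
    intro i
    have h1 := Fin.sum_univ_succAbove (fun j => if j = i then 0 else S i j) i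
    simp only [if_true, zero_add, Fin.succAbove_ne, if_false] at h1
    have h2 : ∀ s, (-1) ^ (i : ℕ) *
        α (Function.update (i.removeNth X) s ⁅X i, i.removeNth X s⁆) = S i (i.succAbove s) := by
      intro s
      simp only [hS]
      rw [removeNth_update_succAbove]
      rfl
    rw [Finset.sum_congr rfl fun s _ => h2 s, ← h1, ← Finset.sum_filter_add_sum_filter_not
      Finset.univ (fun j => j < i)]
    congr 1
    · rw [show Finset.univ.filter (fun j => j < i) = Finset.Iio i by ext; simp]
      exact Finset.sum_congr rfl fun j hj => if_neg (Finset.mem_Iio.1 hj).ne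
    · have : Finset.univ.filter (fun j => ¬ j < i) = insert i (Finset.Ioi i) := by
        ext j; simp [le_iff_eq_or_lt]
      rw [this, Finset.sum_insert (by simp), if_pos rfl, zero_add]
      exact Finset.sum_congr rfl fun j hj => if_neg (Finset.mem_Ioi.1 hj).ne'
  have hsymm : ∑ i, ∑ j ∈ Finset.Iio i, S i j = ∑ i, ∑ j ∈ Finset.Ioi i, S i j := by
    rw [Finset.sum_comm' (s := Finset.univ) (t := fun i => Finset.Iio i)
      (t' := Finset.univ) (s' := fun j => Finset.Ioi j) (by simp)]
    refine Finset.sum_congr rfl fun j _ => Finset.sum_congr rfl fun i hi => ?_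
    exact koszul_bracket_symm α X (Finset.mem_Ioi.1 hi).ne'
  rw [AlternatingMap.alternatizeUncurryFin_apply]
  have hR : ∀ i : Fin (k + 1), (-1) ^ (i : ℕ) • lieAuxₗ α (X i) (i.removeNth X) =
      2 * ((-1) ^ (i : ℕ) * ⁅X i, α (i.removeNth X)⁆) -
        (∑ j ∈ Finset.Iio i, S i j + ∑ j ∈ Finset.Ioi i, S i j) := by
    intro i
    rw [← hinner i, ← Finset.mul_sum]
    simp only [lieAuxₗ, lieAux, LinearMap.coe_mk, AddHom.coe_mk, AlternatingMap.coe_mk,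
      MultilinearMap.coe_mk, zsmul_eq_mul, Int.cast_pow, Int.cast_neg, Int.cast_one]
    ring
  have hL : koszul α X = ∑ i : Fin (k + 1), (-1) ^ (i : ℕ) * ⁅X i, α (i.removeNth X)⁆ -
      ∑ i, ∑ j ∈ Finset.Ioi i, S i j := by
    simp only [koszul, hS, mul_sub, Finset.mul_sum, Finset.sum_sub_distrib]
  rw [Finset.sum_congr rfl fun i _ => hR i, Finset.sum_sub_distrib, Finset.sum_add_distrib,
    hsymm, hL, ← Finset.mul_sum]
  ring

theorem two_mul_cancel {A : Type*} [CommRing A] [Algebra ℝ A] {a b : A} (h : 2 * a = 2 * b) :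
    a = b := by
  have h2 : (algebraMap ℝ A (1 / 2)) * 2 = 1 := by
    rw [show (2 : A) = algebraMap ℝ A 2 from (map_ofNat _ 2).symm, ← map_mul]
    norm_num
  calc a = (algebraMap ℝ A (1 / 2)) * 2 * a := by rw [h2, one_mul]
    _ = (algebraMap ℝ A (1 / 2)) * 2 * b := by rw [mul_assoc, h, mul_assoc]
    _ = b := by rw [h2, one_mul]

theorem koszul_map_swap {k : ℕ} (α : Cochain A L k) (X : Fin (k + 1) → L) {i j : Fin (k + 1)}
    (h : i ≠ j) : koszul α (X ∘ Equiv.swap i j) = - koszul α X := by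
  apply two_mul_cancel
  rw [two_mul_koszul, AlternatingMap.map_swap _ _ h, mul_neg, two_mul_koszul]

theorem koszul_update_smul {k : ℕ} (α : Cochain A L k) (X : Fin (k + 1) → L) (i : Fin (k + 1))
    (g : A) (Y : L) :
    koszul α (Function.update X i (g • Y)) = g * koszul α (Function.update X i Y) := by
  by_cases hi : i = 0
  · subst hi; exact koszul_update_zero_smul α X g Y
  · have h : ∀ Z, koszul α (Function.update X i Z) =
        - koszul α (Function.update (X ∘ Equiv.swap i 0) 0 Z) := by
      intro Z
      rw [← koszul_map_swap α _ hi]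
      congr 1
      funext s
      by_cases h1 : s = i
      · subst h1; simp
      · by_cases h2 : s = 0
        · subst h2; simp [Ne.symm h1, Ne.symm hi]
        · simp [Equiv.swap_apply_of_ne_of_ne h1 h2, h1, h2]
    rw [h, h, koszul_update_zero_smul, mul_neg]

/-- The (Chevalley-Eilenberg, or leafwise de Rham) differential, given by the Koszul formula. -/
noncomputable def dForm (k : ℕ) : Cochain A L k →ₗ[ℝ] Cochain A L (k + 1) where
  toFun α :=
    { toFun := koszul α
      map_update_add' := by
        intro inst X i Y Z
        obtain rfl : inst = instDecidableEqFin _ := Subsingleton.elim _ _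
        apply two_mul_cancel
        rw [mul_add, two_mul_koszul, two_mul_koszul, two_mul_koszul, AlternatingMap.map_update_add]
      map_update_smul' := by
        intro inst X i g Y
        obtain rfl : inst = instDecidableEqFin _ := Subsingleton.elim _ _
        exact koszul_update_smul α X i g Y
      map_eq_zero_of_eq' := by
        intro X i j hX hij
        apply two_mul_cancel
        rw [two_mul_koszul, mul_zero, AlternatingMap.map_eq_zero_of_eq _ _ hX hij] }
  map_add' α β := by
    ext X
    simp only [koszul, AlternatingMap.coe_mk, MultilinearMap.coe_mk, AlternatingMap.add_apply,
      lie_add, ← Finset.sum_add_distrib, ← mul_add]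
    refine Finset.sum_congr rfl fun i _ => ?_
    rw [Finset.sum_add_distrib]
    ring
  map_smul' c α := by
    ext X
    simp only [koszul, AlternatingMap.coe_mk, MultilinearMap.coe_mk, AlternatingMap.smul_apply,
      lie_smul, RingHom.id_apply, ← Finset.smul_sum, ← smul_sub, mul_smul_comm]

/-- The wedge product of cochains,
`(α ∧ β)(X₁, …, Xₖ₊ₗ) = ∑_σ sign σ α(X_σ(1), …, X_σ(k)) β(X_σ(k+1), …, X_σ(k+l))`,
the sum being over all `(k,l)`-shuffles `σ`. -/
noncomputable def wedge {A L : Type*} [CommRing A] [LieRing L] [Module A L] {k l : ℕ}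
    (α : Cochain A L k) (β : Cochain A L l) : Cochain A L (k + l) :=
  ((LinearMap.mul' A A).compAlternatingMap (α.domCoprod β)).domDomCongr finSumFinEquiv

/-- The `n`-fold wedge power `ηⁿ` of a 2-cochain `η`, a cochain of degree `2n`. -/
noncomputable def wedgePow {A L : Type*} [CommRing A] [LieRing L] [Module A L]
    (η : Cochain A L 2) : (n : ℕ) → Cochain A L (2 * n)
  | 0 => (AlternatingMap.constOfIsEmpty A L (Fin 0) 1 : Cochain A L 0)
  | n + 1 => wedge (wedgePow η n) η

variable (A L)

/-- The closed cochains of degree `k`. -/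
noncomputable def closedForms (k : ℕ) : Submodule ℝ (Cochain A L k) :=
  LinearMap.ker (dForm (A := A) (L := L) k)

/-- The exact cochains of degree `k`; only zero is exact in degree `0`. -/
noncomputable def exactForms : (k : ℕ) → Submodule ℝ (Cochain A L k)
  | 0 => ⊥
  | k + 1 => LinearMap.range (dForm (A := A) (L := L) k)

/-- The cohomology space of degree `k`: closed cochains modulo exact ones. -/
abbrev Cohomology (k : ℕ) : Type _ :=
  closedForms A L k ⧸ (exactForms A L k).comap (closedForms A L k).subtype

end LieRinehartAlgebra

/-- The algebra `C^∞(M)` of smooth real functions on an `m`-dimensional manifold. -/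
abbrev SmoothFun (m : ℕ) (M : Type*) [TopologicalSpace M]
    [ChartedSpace (EuclideanSpace ℝ (Fin m)) M] : Type _ :=
  C^∞⟮𝓡 m, M; ℝ⟯

/-- Smooth vector fields on `M`, as derivations of `C^∞(M)`. -/
abbrev SmoothField (m : ℕ) (M : Type*) [TopologicalSpace M]
    [ChartedSpace (EuclideanSpace ℝ (Fin m)) M] : Type _ :=
  Derivation ℝ (SmoothFun m M) (SmoothFun m M)

/-- A Poisson structure on `M`, given by its Poisson bracket: a Lie bracket on `C^∞(M)` that is a
derivation in each argument. -/
structure PoissonStructure (m : ℕ) (M : Type*) [TopologicalSpace M]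
    [ChartedSpace (EuclideanSpace ℝ (Fin m)) M] where
  bracket : SmoothFun m M →ₗ[ℝ] SmoothFun m M →ₗ[ℝ] SmoothFun m M
  bracket_skew : ∀ f g, bracket f g = -bracket g f
  jacobi : ∀ f g h,
    bracket f (bracket g h) + bracket g (bracket h f) + bracket h (bracket f g) = 0
  leibniz : ∀ f g h, bracket f (g * h) = bracket f g * h + g * bracket f h

namespace PoissonStructure

variable {m : ℕ} {M : Type*} [TopologicalSpace M] [ChartedSpace (EuclideanSpace ℝ (Fin m)) M]

/-- The Hamiltonian vector field `X_f = {f, ·}`. -/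
noncomputable def ham (π : PoissonStructure m M) (f : SmoothFun m M) : SmoothField m M :=
  Derivation.mk' (π.bracket f) fun g h => by
    rw [π.leibniz, smul_eq_mul, smul_eq_mul]; ring

@[simp] theorem ham_apply (π : PoissonStructure m M) (f g : SmoothFun m M) :
    π.ham f g = π.bracket f g := rfl

theorem bracket_self (π : PoissonStructure m M) (f : SmoothFun m M) : π.bracket f f = 0 := by
  have h := π.bracket_skew f f
  ext p
  have := congrArg (fun u : SmoothFun m M => u p) h
  have h2 : π.bracket f f p = - π.bracket f f p := this
  simp only [ContMDiffMap.coe_zero, Pi.zero_apply]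
  linarith

/-- The tangent space at `p` of the characteristic foliation: the image of `π^♯` at `p`, that is, the
values at `p` of the Hamiltonian vector fields. Tangent vectors are derivations at `p`. -/
def charSpace (π : PoissonStructure m M) (p : M) : Submodule ℝ (PointDerivation (𝓡 m) p) where
  carrier := {v | ∃ f : SmoothFun m M, v = Derivation.evalAt p (π.ham f)}
  add_mem' := by
    rintro _ _ ⟨f, rfl⟩ ⟨g, rfl⟩
    refine ⟨f + g, Derivation.ext fun h => ?_⟩
    change π.bracket f h p + π.bracket g h p = π.bracket (f + g) h p
    rw [map_add]; rfl
  zero_mem' := by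
    refine ⟨0, Derivation.ext fun h => ?_⟩
    change 0 = π.bracket 0 h p
    rw [map_zero]; rfl
  smul_mem' := by
    rintro c _ ⟨f, rfl⟩
    refine ⟨c • f, Derivation.ext fun h => ?_⟩
    change c • π.bracket f h p = π.bracket (c • f) h p
    rw [map_smul]; rfl

/-- The Poisson structure is regular of rank `k`: the characteristic distribution has dimension `k`
at every point. -/
def IsRegular (π : PoissonStructure m M) (k : ℕ) : Prop :=
  ∀ p : M, Module.rank ℝ (π.charSpace p) = k

/-- The vector field `X` is tangent to the characteristic foliation at every point. -/
def IsTangent (π : PoissonStructure m M) (X : SmoothField m M) : Prop :=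
  ∀ p : M, Derivation.evalAt p X ∈ π.charSpace p

theorem isTangent_iff (π : PoissonStructure m M) (X : SmoothField m M) :
    π.IsTangent X ↔ ∀ p : M, ∃ f : SmoothFun m M, ∀ g, X g p = π.bracket f g p := by
  refine forall_congr' fun p => exists_congr fun f => ?_
  exact ⟨fun h g => congrArg (fun v => v g) h, fun h => Derivation.ext h⟩

theorem isTangent_ham (π : PoissonStructure m M) (f : SmoothFun m M) : π.IsTangent (π.ham f) :=
  fun _ => ⟨f, rfl⟩

/-- Around every point the fields tangent to the foliation are combinations of `k` Hamiltonian
fields, after multiplication with a function that does not vanish at the point. -/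
theorem exists_frame (π : PoissonStructure m M) {k : ℕ} (h : π.IsRegular k) (p : M) :
    ∃ (y : Fin k → SmoothFun m M) (δ : SmoothFun m M), δ p ≠ 0 ∧
      ∀ X : SmoothField m M, π.IsTangent X →
        ∃ c : Fin k → SmoothFun m M, δ • X = ∑ j, c j • π.ham (y j) := by
  classical
  -- a frame of Hamiltonian vectors at `p`
  have hfr : ∀ q, Module.finrank ℝ (π.charSpace q) = k := fun q =>
    Module.finrank_eq_of_rank_eq (h q)
  have hfin : ∀ q, Module.Finite ℝ (π.charSpace q) := fun q =>
    Module.rank_lt_aleph0_iff.1 (by rw [h q]; exact Cardinal.natCast_lt_aleph0)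
  let b : Module.Basis (Fin k) ℝ (π.charSpace p) := Module.finBasisOfFinrankEq ℝ _ (hfr p)
  choose y hy using fun i => (b i).2
  let P : Matrix (Fin k) (Fin k) (SmoothFun m M) := fun i j => π.bracket (y i) (y j)
  let ev : ∀ q : M, SmoothFun m M →+* ℝ := fun q => ContMDiffMap.evalRingHom q
  have hev : ∀ q f, ev q f = f q := fun _ _ => rfl
  -- linear combinations
  have hcomb : ∀ (q : M) (a : Fin k → ℝ) (g : SmoothFun m M),
      π.bracket (∑ i, a i • y i) g q = ∑ i, a i * π.bracket (y i) g q := by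
    intro q a g
    rw [map_sum, LinearMap.sum_apply, ← hev, map_sum]
    refine Finset.sum_congr rfl fun i _ => ?_
    rw [map_smul]; rfl
  have hinj : ∀ q, P.det q ≠ 0 → ∀ a : Fin k → ℝ,
      (∀ j, ∑ i, a i * π.bracket (y i) (y j) q = 0) → a = 0 := by
    intro q hq a ha
    have hd : ((ev q).mapMatrix P).det ≠ 0 := by rw [← RingHom.map_det]; exact hq
    exact Matrix.eq_zero_of_vecMul_eq_zero hd (funext ha)
  -- nondegeneracy at `p`
  have hp : P.det p ≠ 0 := by
    intro h0
    have hd : ((ev p).mapMatrix P).det = 0 := by rw [← RingHom.map_det]; exact h0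
    obtain ⟨a, hane, ha⟩ := Matrix.exists_vecMul_eq_zero_iff.2 hd
    have ha' : ∀ j, π.bracket (∑ i, a i • y i) (y j) p = 0 := fun j => by
      rw [hcomb]; exact congrFun ha j
    set g := ∑ i, a i • y i with hg
    have hv : ∀ v : π.charSpace p, (v : PointDerivation (𝓡 m) p) g = 0 := by
      intro v
      let L : π.charSpace p →ₗ[ℝ] ℝ :=
        { toFun := fun v => (v : PointDerivation (𝓡 m) p) g
          map_add' := fun _ _ => rfl
          map_smul' := fun _ _ => rfl }
      have : L = 0 := b.ext fun j => by
        change (b j : PointDerivation (𝓡 m) p) g = 0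
        rw [hy j]
        change π.bracket (y j) g p = 0
        rw [π.bracket_skew]
        change - π.bracket g (y j) p = 0
        rw [ha' j, neg_zero]
      exact LinearMap.congr_fun this v
    have hz0 : ∀ f : SmoothFun m M, ∑ i, a i * π.bracket (y i) f p = 0 := by
      intro f
      rw [← hcomb, ← hg, π.bracket_skew]
      change - π.bracket f g p = 0
      rw [neg_eq_zero]
      exact hv ⟨_, f, rfl⟩
    have hz : ∑ i, a i • b i = 0 := by
      apply Subtype.ext
      refine Derivation.ext fun f => ?_
      have h1 : ((∑ i, a i • b i : π.charSpace p) : PointDerivation (𝓡 m) p) f =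
          ∑ i, a i * π.bracket (y i) f p := by
        let L : π.charSpace p →ₗ[ℝ] ℝ :=
          { toFun := fun v => (v : PointDerivation (𝓡 m) p) f
            map_add' := fun _ _ => rfl
            map_smul' := fun _ _ => rfl }
        change L _ = _
        rw [map_sum]
        refine Finset.sum_congr rfl fun i _ => ?_
        rw [map_smul, smul_eq_mul]
        change a i * (b i : PointDerivation (𝓡 m) p) f = _
        rw [hy i]; rfl
      exact h1.trans (hz0 f)
    exact hane (funext (Fintype.linearIndependent_iff.1 b.linearIndependent a hz))
  refine ⟨y, P.det * P.det, mul_ne_zero hp hp, fun X hX => ?_⟩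
  let c : Fin k → SmoothFun m M := Matrix.vecMul (fun i => X (y i)) P.adjugate
  have hc : ∀ i, ∑ j, c j * π.bracket (y j) (y i) = P.det * X (y i) := by
    intro i
    have : Matrix.vecMul c P = P.det • (fun i => X (y i)) := by
      rw [Matrix.vecMul_vecMul, Matrix.adjugate_mul, Matrix.vecMul_smul, Matrix.vecMul_one]
    exact congrFun this i
  refine ⟨fun j => P.det * c j, ?_⟩
  refine Derivation.ext fun f => ?_
  have hsum : ∀ (e : Fin k → SmoothFun m M) (g : SmoothFun m M),
      (∑ j, e j • π.ham (y j)) g = ∑ j, e j * π.bracket (y j) g := by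
    intro e g
    rw [← Derivation.coeFnAddMonoidHom_apply, map_sum, Finset.sum_apply]
    rfl
  rw [hsum]
  ext q
  by_cases hq : P.det q = 0
  · have h1 : ((P.det * P.det) • X) f q = P.det q * P.det q * X f q := rfl
    rw [h1, hq, ← hev q (∑ j, P.det * c j * π.bracket (y j) f), map_sum]
    symm
    rw [zero_mul, zero_mul]
    refine Finset.sum_eq_zero fun j _ => ?_
    rw [map_mul, map_mul, hev, hq]; ring
  · -- the Hamiltonian vectors of the frame still span at `q`
    have hli : LinearIndependent ℝ fun j : Fin k =>
        (⟨Derivation.evalAt q (π.ham (y j)), y j, rfl⟩ : π.charSpace q) := by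
      rw [Fintype.linearIndependent_iff]
      intro a ha
      refine congrFun (hinj q hq a fun i => ?_)
      let L : π.charSpace q →ₗ[ℝ] ℝ :=
        { toFun := fun v => (v : PointDerivation (𝓡 m) q) (y i)
          map_add' := fun _ _ => rfl
          map_smul' := fun _ _ => rfl }
      have := congrArg L ha
      rw [map_sum, map_zero] at this
      rw [← this]
      exact Finset.sum_congr rfl fun j _ => by rw [map_smul]; rfl
    have hspan := hli.span_eq_top_of_card_eq_finrank' (by rw [Fintype.card_fin, hfr q])
    obtain ⟨a, ha⟩ := (Submodule.mem_span_range_iff_exists_fun ℝ).1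
      (hspan ▸ Submodule.mem_top : (⟨_, hX q⟩ : π.charSpace q) ∈ Submodule.span ℝ _)
    have hXq : ∀ g, X g q = ∑ j, a j * π.bracket (y j) g q := by
      intro g
      let L : π.charSpace q →ₗ[ℝ] ℝ :=
        { toFun := fun v => (v : PointDerivation (𝓡 m) q) g
          map_add' := fun _ _ => rfl
          map_smul' := fun _ _ => rfl }
      have := congrArg L ha
      rw [map_sum] at this
      refine Eq.trans (Eq.symm this) ?_
      exact Finset.sum_congr rfl fun j _ => by rw [map_smul]; rfl
    have hca : (fun j => c j q - P.det q * a j) = 0 := by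
      refine hinj q hq _ fun i => ?_
      have h1 : ∑ j, c j q * π.bracket (y j) (y i) q = P.det q * X (y i) q := by
        have := congrArg (ev q) (hc i)
        rw [map_sum] at this
        exact this
      rw [hXq, Finset.mul_sum] at h1
      rw [← sub_eq_zero, ← Finset.sum_sub_distrib] at h1
      rw [← h1]
      exact Finset.sum_congr rfl fun j _ => by ring
    change P.det q * P.det q * X f q = _
    rw [← hev q (∑ j, P.det * c j * π.bracket (y j) f), map_sum, hXq, Finset.mul_sum]
    refine Finset.sum_congr rfl fun j _ => ?_
    have hj : c j q = P.det q * a j := sub_eq_zero.1 (congrFun hca j)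
    change _ = P.det q * c j q * π.bracket (y j) f q
    rw [hj]; ring

/-- The vector fields tangent to the characteristic foliation, as a `C^∞(M)`-module. -/
def tangentSubmodule (π : PoissonStructure m M) : Submodule (SmoothFun m M) (SmoothField m M) where
  carrier := {X | π.IsTangent X}
  add_mem' hX hY p := (π.charSpace p).add_mem (hX p) (hY p)
  zero_mem' p := (π.charSpace p).zero_mem
  smul_mem' a _ hX p := (π.charSpace p).smul_mem (a p) (hX p)

theorem span_ham_le (π : PoissonStructure m M) :
    Submodule.span (SmoothFun m M) (Set.range π.ham) ≤ π.tangentSubmodule := by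
  rw [Submodule.span_le]
  rintro _ ⟨f, rfl⟩
  exact π.isTangent_ham f

theorem lie_ham (π : PoissonStructure m M) (f g : SmoothFun m M) :
    ⁅π.ham f, π.ham g⁆ = π.ham (π.bracket f g) := by
  refine Derivation.ext fun h => ?_
  rw [Derivation.commutator_apply]
  simp only [ham_apply]
  have := π.jacobi f g h
  rw [π.bracket_skew h (π.bracket f g), π.bracket_skew h f, map_neg] at this
  linear_combination this

theorem lie_mem_span_ham (π : PoissonStructure m M) {X Y : SmoothField m M}
    (hX : X ∈ Submodule.span (SmoothFun m M) (Set.range π.ham))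
    (hY : Y ∈ Submodule.span (SmoothFun m M) (Set.range π.ham)) :
    ⁅X, Y⁆ ∈ Submodule.span (SmoothFun m M) (Set.range π.ham) := by
  induction hX using Submodule.span_induction with
  | mem X hX =>
    obtain ⟨f, rfl⟩ := hX
    induction hY using Submodule.span_induction with
    | mem Y hY =>
      obtain ⟨g, rfl⟩ := hY
      rw [lie_ham]
      exact Submodule.subset_span ⟨_, rfl⟩
    | zero =>
      have e : ⁅π.ham f, (0 : SmoothField m M)⁆ = 0 := lie_zero _
      rw [e]
      exact Submodule.zero_mem _
    | add Y Z _ _ h1 h2 => exact (lie_add (π.ham f) Y Z : ⁅π.ham f, Y + Z⁆ = _) ▸ Submodule.add_mem _ h1 h2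
    | smul a Y hY h =>
      rw [LieRinehartRing.leibniz_smul_right]
      exact Submodule.add_mem _ (Submodule.smul_mem _ _ h) (Submodule.smul_mem _ _ hY)
  | zero =>
    have e : ⁅(0 : SmoothField m M), Y⁆ = 0 := zero_lie Y
    rw [e]
    exact Submodule.zero_mem _
  | add X Z _ _ h1 h2 =>
    exact (add_lie X Z Y : ⁅X + Z, Y⁆ = _) ▸ Submodule.add_mem _ h1 h2
  | smul a X hX h =>
    rw [← lie_skew, LieRinehartRing.leibniz_smul_right, ← lie_skew Y X]
    exact Submodule.neg_mem _ (Submodule.add_mem _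
      (Submodule.smul_mem _ _ (Submodule.neg_mem _ h)) (Submodule.smul_mem _ _ hX))

theorem exists_smul_mem_span_ham (π : PoissonStructure m M) {k : ℕ} (h : π.IsRegular k) (p : M)
    {X : SmoothField m M} (hX : π.IsTangent X) : ∃ δ : SmoothFun m M, δ p ≠ 0 ∧
      δ • X ∈ Submodule.span (SmoothFun m M) (Set.range π.ham) := by
  obtain ⟨y, δ, hδ, hy⟩ := π.exists_frame h p
  obtain ⟨c, hc⟩ := hy X hX
  refine ⟨δ, hδ, ?_⟩
  rw [hc]
  exact Submodule.sum_mem _ fun j _ => Submodule.smul_mem _ _ (Submodule.subset_span ⟨_, rfl⟩)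

theorem isTangent_lie (π : PoissonStructure m M) {k : ℕ} (h : π.IsRegular k)
    {X Y : SmoothField m M} (hX : π.IsTangent X) (hY : π.IsTangent Y) : π.IsTangent ⁅X, Y⁆ := by
  intro p
  obtain ⟨a, ha, haX⟩ := π.exists_smul_mem_span_ham h p hX
  obtain ⟨b, hb, hbY⟩ := π.exists_smul_mem_span_ham h p hY
  have h1 := π.span_ham_le (π.lie_mem_span_ham haX hbY) p
  have e : ⁅a • X, b • Y⁆ = (a * b) • ⁅X, Y⁆ + (a * X b) • Y - (b * Y a) • X := by
    refine Derivation.ext fun f => ?_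
    simp only [Derivation.commutator_apply, Derivation.sub_apply, Derivation.add_apply,
      Derivation.smul_apply, smul_eq_mul, Derivation.leibniz]
    ring
  rw [e] at h1
  have h2 : (a p * b p) • Derivation.evalAt p ⁅X, Y⁆ + (a p * X b p) • Derivation.evalAt p Y -
      (b p * Y a p) • Derivation.evalAt p X ∈ π.charSpace p := h1
  have h3 := (π.charSpace p).sub_mem
    ((π.charSpace p).add_mem h2 ((π.charSpace p).smul_mem (b p * Y a p) (hX p)))
    ((π.charSpace p).smul_mem (a p * X b p) (hY p))
  rw [sub_add_cancel, add_sub_cancel_right] at h3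
  exact ((π.charSpace p).smul_mem_iff (mul_ne_zero ha hb)).1 h3

/-- The vector fields tangent to the characteristic foliation of a regular Poisson structure. They
are closed under the Lie bracket, and form a Lie-Rinehart algebra over `C^∞(M)`. -/
def leafwiseFields (π : PoissonStructure m M) {k : ℕ} (h : π.IsRegular k) :
    LieRinehartSubalgebra (SmoothFun m M) (SmoothField m M) where
  toSubmodule := π.tangentSubmodule
  lie_mem' hX hY := π.isTangent_lie h hX hY

/-- The leafwise symplectic form at a point: `ω(X, Y)(p) = X_p(g)` where `Y_p = X_g(p)`, so that
`ω(X_f, X_g) = {f, g}`. -/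
noncomputable def pairing (π : PoissonStructure m M) {X Y : SmoothField m M}
    (_hX : π.IsTangent X) (hY : π.IsTangent Y) (p : M) : ℝ :=
  X (hY p).choose p

theorem pairing_eq (π : PoissonStructure m M) {X Y : SmoothField m M}
    (hX : π.IsTangent X) (hY : π.IsTangent Y) (p : M) {f g : SmoothFun m M}
    (hf : ∀ u, X u p = π.bracket f u p) (hg : ∀ u, Y u p = π.bracket g u p) :
    π.pairing hX hY p = π.bracket f g p := by
  have hs : ∀ u v, π.bracket u v p = - π.bracket v u p := fun u v => by
    rw [π.bracket_skew]; rfl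
  have h1 : ∀ u, Y u p = π.bracket (hY p).choose u p :=
    fun u => congrArg (fun v => v u) (hY p).choose_spec
  rw [pairing, hf, hs, ← h1, hg, hs g, neg_neg]

theorem pairing_eq_left (π : PoissonStructure m M) {X Y : SmoothField m M}
    (hX : π.IsTangent X) (hY : π.IsTangent Y) (p : M) {g : SmoothFun m M}
    (hg : ∀ u, Y u p = π.bracket g u p) :
    π.pairing hX hY p = X g p := by
  obtain ⟨f, hf⟩ := (π.isTangent_iff X).1 hX p
  rw [π.pairing_eq hX hY p hf hg, hf]

theorem pairing_eq_right (π : PoissonStructure m M) {X Y : SmoothField m M}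
    (hX : π.IsTangent X) (hY : π.IsTangent Y) (p : M) {f : SmoothFun m M}
    (hf : ∀ u, X u p = π.bracket f u p) :
    π.pairing hX hY p = - Y f p := by
  obtain ⟨g, hg⟩ := (π.isTangent_iff Y).1 hY p
  rw [π.pairing_eq hX hY p hf hg, hg, π.bracket_skew]
  rfl

theorem pairing_add_left (π : PoissonStructure m M) {X X' Y : SmoothField m M}
    (hX : π.IsTangent X) (hX' : π.IsTangent X') (hXX : π.IsTangent (X + X'))
    (hY : π.IsTangent Y) (p : M) :
    π.pairing hXX hY p = π.pairing hX hY p + π.pairing hX' hY p := rfl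

theorem pairing_smul_left (π : PoissonStructure m M) {X Y : SmoothField m M} (a : SmoothFun m M)
    (hX : π.IsTangent X) (haX : π.IsTangent (a • X)) (hY : π.IsTangent Y) (p : M) :
    π.pairing haX hY p = a p * π.pairing hX hY p := rfl

theorem pairing_skew (π : PoissonStructure m M) {X Y : SmoothField m M}
    (hX : π.IsTangent X) (hY : π.IsTangent Y) (p : M) :
    π.pairing hX hY p = - π.pairing hY hX p := by
  obtain ⟨f, hf⟩ := (π.isTangent_iff X).1 hX p
  rw [π.pairing_eq_right hX hY p hf, π.pairing_eq_left hY hX p hf]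

theorem contMDiff_pairing (π : PoissonStructure m M) {k : ℕ} (h : π.IsRegular k)
    {X Y : SmoothField m M} (hX : π.IsTangent X) (hY : π.IsTangent Y) :
    ContMDiff (𝓡 m) 𝓘(ℝ, ℝ) ∞ (π.pairing hX hY) := by
  intro p
  obtain ⟨y, δ, hδ, hy⟩ := π.exists_frame h p
  obtain ⟨c, hc⟩ := hy Y hY
  have key : ∀ q, δ q * π.pairing hX hY q = (∑ j, c j * X (y j) : SmoothFun m M) q := by
    intro q
    obtain ⟨f, hf⟩ := (π.isTangent_iff X).1 hX q
    rw [π.pairing_eq_right hX hY q hf]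
    have h1 : δ q * Y f q = (ContMDiffMap.evalRingHom q : SmoothFun m M →+* ℝ)
        ((∑ j, c j • π.ham (y j)) f) := by
      rw [← hc]; rfl
    rw [← Derivation.coeFnAddMonoidHom_apply (∑ j, c j • π.ham (y j)), map_sum, Finset.sum_apply,
      map_sum] at h1
    change _ = (ContMDiffMap.evalRingHom q : SmoothFun m M →+* ℝ) (∑ j, c j * X (y j))
    rw [map_sum, mul_neg, h1, ← Finset.sum_neg_distrib]
    refine Finset.sum_congr rfl fun j _ => ?_
    change -(c j q * π.bracket (y j) f q) = c j q * X (y j) q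
    rw [hf, π.bracket_skew]
    change -(c j q * -π.bracket f (y j) q) = _
    ring
  have hne : ∀ᶠ q in nhds p, δ q ≠ 0 := δ.contMDiff.continuous.continuousAt.eventually_ne hδ
  have hq := ((∑ j, c j * X (y j) : SmoothFun m M).contMDiff p).div₀ (δ.contMDiff p) hδ
  refine hq.congr_of_eventuallyEq ?_
  filter_upwards [hne] with q hq
  rw [Pi.div_apply, ← key q, mul_div_cancel_left₀ _ hq]

/-- The leafwise differential forms of degree `j` on the characteristic foliation: alternating
`C^∞(M)`-multilinear maps on the vector fields tangent to the foliation. -/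
abbrev FoliatedForm (π : PoissonStructure m M) {k : ℕ} (h : π.IsRegular k) (j : ℕ) : Type _ :=
  LieRinehartAlgebra.Cochain (SmoothFun m M) (π.leafwiseFields h) j

/-- The leafwise de Rham differential. -/
noncomputable abbrev foliatedD (π : PoissonStructure m M) {k : ℕ} (h : π.IsRegular k) (j : ℕ) :
    π.FoliatedForm h j →ₗ[ℝ] π.FoliatedForm h (j + 1) :=
  LieRinehartAlgebra.dForm j

/-- The leafwise closed forms of degree `j`. -/
noncomputable abbrev closedForms (π : PoissonStructure m M) {k : ℕ} (h : π.IsRegular k) (j : ℕ) :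
    Submodule ℝ (π.FoliatedForm h j) :=
  LieRinehartAlgebra.closedForms (SmoothFun m M) (π.leafwiseFields h) j

/-- The leafwise exact forms of degree `j`. -/
noncomputable abbrev exactForms (π : PoissonStructure m M) {k : ℕ} (h : π.IsRegular k) (j : ℕ) :
    Submodule ℝ (π.FoliatedForm h j) :=
  LieRinehartAlgebra.exactForms (SmoothFun m M) (π.leafwiseFields h) j

/-- The foliated cohomology of degree `j` of the characteristic foliation. -/
abbrev FoliatedCohomology (π : PoissonStructure m M) {k : ℕ} (h : π.IsRegular k) (j : ℕ) :
    Type _ :=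
  LieRinehartAlgebra.Cohomology (SmoothFun m M) (π.leafwiseFields h) j

/-- The class of a leafwise closed form in foliated cohomology. -/
noncomputable def foliatedClass (π : PoissonStructure m M) {k : ℕ} (h : π.IsRegular k) {j : ℕ}
    (α : π.FoliatedForm h j) (hα : π.foliatedD h j α = 0) : π.FoliatedCohomology h j :=
  Submodule.Quotient.mk ⟨α, LinearMap.mem_ker.2 hα⟩

theorem isTangent_coe (π : PoissonStructure m M) {k : ℕ} (h : π.IsRegular k)
    (X : π.leafwiseFields h) : π.IsTangent (X : SmoothField m M) := X.2

/-- The leafwise symplectic form of a regular Poisson structure, the leafwise 2-form with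
`ω(X_f, X_g) = {f, g}`. -/
noncomputable def leafwiseSymplectic (π : PoissonStructure m M) {k : ℕ} (h : π.IsRegular k) :
    π.FoliatedForm h 2 where
  toFun v := ⟨π.pairing (π.isTangent_coe h (v 0)) (π.isTangent_coe h (v 1)),
    π.contMDiff_pairing h (π.isTangent_coe h (v 0)) (π.isTangent_coe h (v 1))⟩
  map_update_add' := by
    intro inst v i X Y
    obtain rfl : inst = instDecidableEqFin 2 := Subsingleton.elim _ _
    ext p
    fin_cases i
    · rfl
    · change π.pairing (π.isTangent_coe h (v 0)) (π.isTangent_coe h (X + Y)) p =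
        π.pairing (π.isTangent_coe h (v 0)) (π.isTangent_coe h X) p +
        π.pairing (π.isTangent_coe h (v 0)) (π.isTangent_coe h Y) p
      rw [π.pairing_skew, π.pairing_skew (π.isTangent_coe h (v 0)) (π.isTangent_coe h X),
        π.pairing_skew (π.isTangent_coe h (v 0)) (π.isTangent_coe h Y), ← neg_add]
      rfl
  map_update_smul' := by
    intro inst v i a X
    obtain rfl : inst = instDecidableEqFin 2 := Subsingleton.elim _ _
    ext p
    fin_cases i
    · rfl
    · change π.pairing (π.isTangent_coe h (v 0)) (π.isTangent_coe h (a • X)) p =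
        a p * π.pairing (π.isTangent_coe h (v 0)) (π.isTangent_coe h X) p
      rw [π.pairing_skew, π.pairing_skew (π.isTangent_coe h (v 0)) (π.isTangent_coe h X),
        mul_neg]
      rfl
  map_eq_zero_of_eq' := by
    intro v i j hv hij
    have h01 : v 0 = v 1 := by
      fin_cases i <;> fin_cases j <;> simp_all
    ext p
    change π.pairing (π.isTangent_coe h (v 0)) (π.isTangent_coe h (v 1)) p = 0
    have hs : π.pairing (π.isTangent_coe h (v 1)) (π.isTangent_coe h (v 1)) p = 0 := by
      have := π.pairing_skew (π.isTangent_coe h (v 1)) (π.isTangent_coe h (v 1)) p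
      linarith
    rw [← hs]
    simp only [h01]

theorem leafwiseSymplectic_ham (π : PoissonStructure m M) {k : ℕ} (h : π.IsRegular k)
    (f g : SmoothFun m M) :
    π.leafwiseSymplectic h ![⟨π.ham f, π.isTangent_ham f⟩, ⟨π.ham g, π.isTangent_ham g⟩] =
      π.bracket f g := by
  ext p
  exact π.pairing_eq (π.isTangent_ham f) (π.isTangent_ham g) p (fun _ => rfl) (fun _ => rfl)

/-- The leafwise Liouville form `ωⁿ/n!` of a Poisson structure that is regular of rank `2n`. -/
noncomputable def liouville (π : PoissonStructure m M) {n : ℕ} (h : π.IsRegular (2 * n)) :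
    π.FoliatedForm h (2 * n) :=
  ((n.factorial : ℝ)⁻¹) • LieRinehartAlgebra.wedgePow (π.leafwiseSymplectic h) n

/-- The map `f ↦ f ωⁿ/n!` from smooth functions to leafwise forms of top degree. -/
noncomputable def toTopForm (π : PoissonStructure m M) {n : ℕ} (h : π.IsRegular (2 * n)) :
    SmoothFun m M →ₗ[ℝ] π.FoliatedForm h (2 * n) where
  toFun f := f • π.liouville h
  map_add' f g := add_smul f g _
  map_smul' c f := by
    ext1 v
    exact smul_mul_assoc c f (π.liouville h v)

/-- The linear span `{C^∞(M), C^∞(M)}` of the Poisson brackets. -/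
noncomputable def bracketSpan (π : PoissonStructure m M) : Submodule ℝ (SmoothFun m M) :=
  Submodule.span ℝ {u | ∃ f g, u = π.bracket f g}

/-- The zeroth Poisson homology `C^∞(M) / {C^∞(M), C^∞(M)}`. -/
abbrev PoissonH0 (π : PoissonStructure m M) : Type _ :=
  SmoothFun m M ⧸ π.bracketSpan

end PoissonStructure

/-!
Let `μ = ωⁿ/n!`. On a Hamiltonian frame the foliation has `2n` directions, so there are no leafwise
forms of degree greater than `2n`, and `φ(f) = f μ` is closed. The form `μ` vanishes nowhere: up to
a positive factor `ωⁿ` is the sum over all permutations of `2n` indices which gives the Pfaffian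
(`exists_smul_wedgePow_eq`), and on a symplectic basis all terms of this sum are nonnegative and
one is positive (`exists_liouville_ne_zero`). Hence `φ` is bijective onto the forms of top degree
(`exists_smul_volume_eq`).

Hamiltonian fields preserve `ω` by the Jacobi identity, hence they preserve `μ`, and Cartan's
formula gives `d(ι_{X_f} (g μ)) = L_{X_f} (g μ) = {f, g} μ` (`foliatedD_curryLeft`). So brackets are
mapped to exact forms. For the converse every form of degree `2n - 1` has to be a *finite* sum
`∑ gᵢ ι_{X_{Fᵢ}} μ`. Locally this is linear algebra, and the coefficients are glued by a partition
of unity, since the conditions on them are affine (`exists_eq_sum_curryLeft`). What is needed globally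
is a finite family `Fᵢ` whose Hamiltonian fields span the characteristic space at every point, also
if `M` is not compact (`exists_finite_separates`). This is the leafwise analogue of the existence of
an immersion into a Euclidean space, and is proved in the same way. On a compact set finitely many
functions suffice. By a generic projection their number can be reduced to `m + 2n + 1`, because the
values of Hamiltonian vectors on `N` functions form a set of Hausdorff dimension at most `m + 2n` in
`ℝᴺ`. With this uniform bound the families on the compact slabs of a proper function can be glued.

Since a family spans the characteristic spaces if and only if no nonzero Hamiltonian vector
annihilates all its members, the span condition is expressed by brackets alone (`Separates`).
-/

/-! ### Cochains on a Lie-Rinehart algebra: top degree, codegree one, Cartan's formula -/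

namespace LieRinehartAlgebra

section Cochain

variable {A L : Type*} [CommRing A] [LieRing L] [Module A L]

theorem alternating_sum_apply {V ι κ : Type*} [AddCommGroup V] [Module A V] (s : Finset κ)
    (f : κ → V [⋀^ι]→ₗ[A] A) (v : ι → V) : (∑ j ∈ s, f j) v = ∑ j ∈ s, f j v :=
  map_sum (⟨⟨fun g : V [⋀^ι]→ₗ[A] A => g v, rfl⟩, fun _ _ => rfl⟩ : (V [⋀^ι]→ₗ[A] A) →+ A) f s

/-- The pullback of a cochain to the free module on a finite family of elements of `L`. -/
noncomputable def restrictFamily {ι : Type*} [Fintype ι] {k : ℕ} (α : Cochain A L k) (y : ι → L) :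
    (ι → A) [⋀^Fin k]→ₗ[A] A :=
  α.compLinearMap (Fintype.linearCombination A y)

theorem restrictFamily_apply {ι : Type*} [Fintype ι] {k : ℕ} (α : Cochain A L k) (y : ι → L)
    (c : Fin k → ι → A) :
    restrictFamily α y c = α fun i => ∑ j, c i j • y j := rfl

theorem restrictFamily_basis {ι : Type*} [Fintype ι] [DecidableEq ι] {k : ℕ} (α : Cochain A L k)
    (y : ι → L) (s : Fin k → ι) :
    (restrictFamily α y fun i => Pi.basisFun A ι (s i)) = α (y ∘ s) := by
  rw [restrictFamily_apply]
  congr 1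
  funext i
  simp [Pi.single_apply]

theorem map_linearCombination_eq_det_mul {k : ℕ} (α : Cochain A L k) (y : Fin k → L)
    (c : Fin k → Fin k → A) :
    (α fun i => ∑ j, c i j • y j) = Matrix.det c * α y := by
  have h := congrArg (fun f => f c)
    ((restrictFamily α y).eq_smul_basis_det (Pi.basisFun A (Fin k)))
  have h2 := restrictFamily_basis α y id
  rw [← restrictFamily_apply]
  refine h.trans ?_
  change restrictFamily α y (fun i => Pi.basisFun A (Fin k) (id i)) *
    (Pi.basisFun A (Fin k)).det c = _
  rw [h2, Pi.basisFun_det, mul_comm]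
  rfl

/-- An alternating map of more than `k` arguments vanishes on the span of `k` elements. -/
theorem map_linearCombination_eq_zero {k l : ℕ} (hkl : k < l) (α : Cochain A L l) (y : Fin k → L)
    (c : Fin l → Fin k → A) : (α fun i => ∑ j, c i j • y j) = 0 := by
  have h : restrictFamily α y = 0 :=
    Module.Basis.ext_alternating (Pi.basisFun A (Fin k)) fun v hv => by
      have := Fintype.card_le_of_injective v hv
      simp only [Fintype.card_fin] at this
      omega
  rw [← restrictFamily_apply, h]
  rfl

/-- An injection of `Fin k` into `Fin (k + 1)` omits exactly one index. -/
theorem exists_succAbove_comp_perm {k : ℕ} {v : Fin k → Fin (k + 1)} (hv : Function.Injective v) :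
    ∃ (i : Fin (k + 1)) (σ : Equiv.Perm (Fin k)), v = i.succAbove ∘ σ := by
  obtain ⟨i, hi⟩ : ∃ i, i ∉ Set.range v := by
    by_contra! hall
    have := Fintype.card_le_of_surjective v hall
    simp at this
  have hne : ∀ j, ∃ l, i.succAbove l = v j := fun j =>
    Fin.exists_succAbove_eq fun h => hi ⟨j, h⟩
  choose τ hτ using hne
  have hinj : Function.Injective τ := fun a b hab => hv (by rw [← hτ, ← hτ, hab])
  refine ⟨i, Equiv.ofBijective τ (Finite.injective_iff_bijective.1 hinj), ?_⟩
  funext j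
  exact (hτ j).symm

/-- A cochain `β` of degree one less than the number of members of a family `y` is, on the span of
the family, the contraction of any cochain `μ` of top degree with the vector
`∑ j, (-1)^j β(…, ŷⱼ, …) yⱼ`, up to the factor `μ y`. -/
theorem mul_map_linearCombination_eq_sum {k : ℕ} (μ : Cochain A L (k + 1)) (β : Cochain A L k)
    (y : Fin (k + 1) → L) (c : Fin k → Fin (k + 1) → A) :
    μ y * (β fun i => ∑ j, c i j • y j) =
      ∑ j : Fin (k + 1), (-1) ^ (j : ℕ) * β (j.removeNth y) *
        (μ.curryLeft (y j) fun i => ∑ l, c i l • y l) := by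
  have h : μ y • restrictFamily β y = ∑ j : Fin (k + 1),
      ((-1) ^ (j : ℕ) * β (j.removeNth y)) • restrictFamily (μ.curryLeft (y j)) y := by
    refine Module.Basis.ext_alternating (Pi.basisFun A (Fin (k + 1))) fun v hv => ?_
    obtain ⟨i, σ, rfl⟩ := exists_succAbove_comp_perm hv
    rw [AlternatingMap.smul_apply, alternating_sum_apply, restrictFamily_basis,
      Finset.sum_eq_single i]
    · have e : μ.curryLeft (y i) (y ∘ i.succAbove) = (-1) ^ (i : ℕ) * μ y := by
        have := AlternatingMap.neg_one_pow_smul_map_insertNth μ i (y i) (i.removeNth y)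
        rw [Fin.insertNth_self_removeNth] at this
        rw [AlternatingMap.curryLeft_apply_apply]
        refine this.symm.trans ?_
        simp
      rw [AlternatingMap.smul_apply, restrictFamily_basis, ← Function.comp_assoc,
        AlternatingMap.map_perm, AlternatingMap.map_perm, e]
      have hs : ((-1 : A) ^ (i : ℕ)) * (-1) ^ (i : ℕ) = 1 := by
        rw [← mul_pow]; simp
      change μ y * _ = _
      rw [smul_eq_mul, mul_smul_comm, mul_smul_comm]
      congr 1
      change μ y * β (i.removeNth y) = _
      linear_combination -(μ y * β (i.removeNth y)) * hs
    · intro j _ hj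
      rw [AlternatingMap.smul_apply, restrictFamily_basis, ← Function.comp_assoc,
        AlternatingMap.map_perm]
      obtain ⟨j', rfl⟩ := Fin.exists_succAbove_eq hj
      rw [AlternatingMap.curryLeft_apply_apply, AlternatingMap.map_eq_zero_of_eq _ _ (i := 0)
        (j := j'.succ) (by simp) (Fin.succ_ne_zero j').symm, smul_zero, smul_zero]
    · simp
  have h2 := congrArg (fun f => f c) h
  simp only [AlternatingMap.smul_apply, alternating_sum_apply, smul_eq_mul] at h2
  exact h2

end Cochain

section Lie

variable {A L : Type*} [CommRing A] [LieRing L] [Module A L] [LieRingModule L A]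

/-- The Lie derivative `X(α(v)) - ∑ s, α(…, [X, vₛ], …)` of a cochain, as a function of `v`. -/
def lieDeriv {k : ℕ} (X : L) (α : Cochain A L k) (v : Fin k → L) : A :=
  ⁅X, α v⁆ - ∑ s, α (Function.update v s ⁅X, v s⁆)

theorem koszul_cons {k : ℕ} (α : Cochain A L (k + 1)) (X : L) (v : Fin (k + 1) → L) :
    koszul α (Fin.cons X v) = lieDeriv X α v - koszul (α.curryLeft X) v := by
  unfold koszul lieDeriv
  rw [Fin.sum_univ_succ, Fin.sum_Ioi_zero]
  have h0 : ∀ w : Fin (k + 1) → L,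
      (0 : Fin (k + 2)).removeNth (Fin.cons X w : Fin (k + 2) → L) = w :=
    fun w => Fin.removeNth_zero _
  have hs : ∀ (i : Fin (k + 1)) (w : Fin (k + 1) → L),
      α (i.succ.removeNth (Fin.cons X w : Fin (k + 2) → L)) = α.curryLeft X (i.removeNth w) := by
    intro i w
    rw [AlternatingMap.curryLeft_apply_apply]
    congr 1
    funext s
    refine Fin.cases ?_ (fun s => ?_) s <;> simp [Fin.removeNth]
  simp only [Fin.val_zero, pow_zero, one_mul, Fin.cons_zero, Fin.cons_succ, ← Fin.cons_update,
    Fin.sum_Ioi_succ, h0, hs, Fin.val_succ, pow_succ, mul_neg, mul_one, neg_mul,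
    Finset.sum_neg_distrib, ← sub_eq_add_neg]

variable [LieRinehartRing A L] [Algebra ℝ A] [LieAlgebra ℝ L] [LieRinehartAlgebra ℝ A L]

/-- Cartan's formula. -/
theorem dForm_curryLeft_add {k : ℕ} (α : Cochain A L (k + 1)) (X : L) (v : Fin (k + 1) → L) :
    dForm k (α.curryLeft X) v + dForm (k + 1) α (Fin.cons X v) = lieDeriv X α v := by
  change koszul _ _ + koszul _ _ = _
  rw [koszul_cons, add_sub_cancel]

end Lie

end LieRinehartAlgebra

/-! ### Powers of a 2-cochain -/

namespace LieRinehartAlgebra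

section Wedge

variable {A L : Type*} [CommRing A] [LieRing L] [Module A L]

/-- The shuffle sum that defines the wedge product, as a sum over all permutations. -/
theorem factorial_smul_wedge {k l : ℕ} (α : Cochain A L k) (β : Cochain A L l)
    (v : Fin (k + l) → L) :
    (k.factorial * l.factorial) • wedge α β v = ∑ σ : Equiv.Perm (Fin k ⊕ Fin l),
      Equiv.Perm.sign σ • ((α fun i => v (finSumFinEquiv (σ (Sum.inl i)))) *
        (β fun i => v (finSumFinEquiv (σ (Sum.inr i))))) := by
  have h := congrArg (fun f => LinearMap.mul' A A (f (v ∘ finSumFinEquiv)))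
    (MultilinearMap.domCoprod_alternization_eq α β)
  simp only [Fintype.card_fin] at h
  have h2 : LinearMap.mul' A A (((k.factorial * l.factorial) • α.domCoprod β)
      (v ∘ finSumFinEquiv)) = (k.factorial * l.factorial) • wedge α β v := by
    rw [AlternatingMap.smul_apply, map_nsmul]
    rfl
  rw [← h2, ← h, MultilinearMap.alternatization_apply, map_sum]
  refine Finset.sum_congr rfl fun σ _ => ?_
  rw [Units.smul_def, Units.smul_def, map_zsmul]
  rfl

/-- The splitting of `n + 1` pairs of indices into the first `n` pairs and the last one. -/
def splitLastPair (n : ℕ) : Fin n × Fin 2 ⊕ Fin 2 ≃ Fin (n + 1) × Fin 2 where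
  toFun := Sum.elim (fun x => (x.1.castSucc, x.2)) fun b => (Fin.last n, b)
  invFun x := Fin.lastCases (motive := fun _ => Fin n × Fin 2 ⊕ Fin 2) (Sum.inr x.2)
    (fun i => Sum.inl (i, x.2)) x.1
  left_inv x := by rcases x with ⟨i, b⟩ | b <;> simp
  right_inv x := by
    obtain ⟨i, b⟩ := x
    refine Fin.lastCases ?_ (fun i => ?_) i <;> simp

/-- The sum `∑ σ, sign σ ∏ i, η(v_σ(i,0), v_σ(i,1))` over all permutations of the `2n` indices
`(i, b)`, which is `n! 2ⁿ` times the Pfaffian of the matrix of `η` on `v`. -/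
noncomputable def pfaffianSum (η : Cochain A L 2) {n : ℕ} (v : Fin n × Fin 2 → L) : A :=
  ∑ σ : Equiv.Perm (Fin n × Fin 2), Equiv.Perm.sign σ •
    ∏ i, η fun b => v (σ (i, b))

/-- The expansion of the permutation sum along the last pair, before division by the order of the
group of permutations of the first `2 * n` indices. -/
theorem sum_pfaffianSum_mul (η : Cochain A L 2) {n : ℕ}
    (v : Fin (n + 1) × Fin 2 → L) :
    ∑ σ : Equiv.Perm (Fin n × Fin 2 ⊕ Fin 2), Equiv.Perm.sign σ •
      ((pfaffianSum η fun x => v (splitLastPair n (σ (Sum.inl x)))) *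
        η fun b => v (splitLastPair n (σ (Sum.inr b)))) =
      (2 * n).factorial • pfaffianSum η v := by
  have h1 : ∀ τ : Equiv.Perm (Fin n × Fin 2),
      ∑ σ : Equiv.Perm (Fin n × Fin 2 ⊕ Fin 2), Equiv.Perm.sign σ •
        ((Equiv.Perm.sign τ • ∏ i, η fun b => v (splitLastPair n (σ (Sum.inl (τ (i, b)))))) *
        η fun b => v (splitLastPair n (σ (Sum.inr b)))) = pfaffianSum η v := by
    intro τ
    refine Fintype.sum_equiv
      ((Equiv.mulRight (Equiv.Perm.sumCongr τ 1)).trans (splitLastPair n).permCongr) _ _ fun σ => ?_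
    rw [Equiv.trans_apply, Equiv.coe_mulRight, Equiv.Perm.sign_permCongr, Equiv.Perm.sign_mul,
      Equiv.Perm.sign_sumCongr, Equiv.Perm.sign_one, mul_one, mul_smul, smul_mul_assoc]
    congr 2
    rw [Fin.prod_univ_castSucc]
    simp [splitLastPair, Equiv.permCongr_apply]
  have h2 : ∀ σ : Equiv.Perm (Fin n × Fin 2 ⊕ Fin 2), Equiv.Perm.sign σ •
      ((pfaffianSum η fun x => v (splitLastPair n (σ (Sum.inl x)))) *
        η fun b => v (splitLastPair n (σ (Sum.inr b)))) =
      ∑ τ : Equiv.Perm (Fin n × Fin 2), Equiv.Perm.sign σ •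
        ((Equiv.Perm.sign τ • ∏ i, η fun b => v (splitLastPair n (σ (Sum.inl (τ (i, b)))))) *
        η fun b => v (splitLastPair n (σ (Sum.inr b)))) := by
    intro σ
    rw [← Finset.smul_sum, ← Finset.sum_mul]
    rfl
  rw [Finset.sum_congr rfl fun σ _ => h2 σ, Finset.sum_comm, Finset.sum_congr rfl fun τ _ => h1 τ,
    Finset.sum_const, Finset.card_univ, Fintype.card_perm, Fintype.card_prod, Fintype.card_fin,
    Fintype.card_fin, mul_comm]

/-- The wedge powers of a 2-cochain are nonzero multiples of the sum over all permutations. -/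
theorem exists_smul_wedgePow_eq (η : Cochain A L 2) (n : ℕ) :
    ∃ (c : ℕ) (_ : c ≠ 0) (d : ℕ) (_ : d ≠ 0) (e : Fin n × Fin 2 ≃ Fin (2 * n)),
      ∀ v : Fin (2 * n) → L, c • wedgePow η n v = d • pfaffianSum η (v ∘ e) := by
  induction n with
  | zero =>
    have : IsEmpty (Fin (2 * 0)) := inferInstanceAs (IsEmpty (Fin 0))
    refine ⟨1, one_ne_zero, 1, one_ne_zero, Equiv.equivOfIsEmpty _ _, fun v => ?_⟩
    rw [one_smul, one_smul]
    rw [pfaffianSum, Fintype.sum_eq_single 1 fun σ hσ => absurd (Subsingleton.elim σ 1) hσ]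
    simp [wedgePow]
  | succ n ih =>
    obtain ⟨c, hc, d, hd, e, he⟩ := ih
    let E : Fin (n + 1) × Fin 2 ≃ Fin (2 * (n + 1)) :=
      (splitLastPair n).symm.trans ((Equiv.sumCongr e (Equiv.refl _)).trans finSumFinEquiv)
    refine ⟨c * ((2 * n).factorial * Nat.factorial 2), by positivity, d * (2 * n).factorial,
      by positivity, E, fun v => ?_⟩
    have h := factorial_smul_wedge (wedgePow η n) η v
    change _ • wedgePow η (n + 1) v = _ at h
    rw [mul_smul, h, Finset.smul_sum, mul_smul, ← sum_pfaffianSum_mul, Finset.smul_sum]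
    refine Fintype.sum_equiv (Equiv.permCongr (Equiv.sumCongr e (Equiv.refl _)).symm) _ _
      fun σ => ?_
    rw [Equiv.Perm.sign_permCongr, smul_comm, smul_comm d, ← smul_mul_assoc, he, smul_mul_assoc]
    congr 3
    · congr 1
      funext x
      simp [E, Equiv.permCongr_apply]
    · congr 1
      funext x
      simp [E, Equiv.permCongr_apply]

/-- For the matrix `B` of the standard symplectic form, a permutation contributes to the Pfaffian
only if it maps pairs to pairs, and then its sign is cancelled by the signs of the entries of `B`. -/
theorem sign_smul_prod_standard_nonneg {n : ℕ} {B : Fin n × Fin 2 → Fin n × Fin 2 → ℝ}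
    (h01 : ∀ i, B (i, 0) (i, 1) = 1) (h10 : ∀ i, B (i, 1) (i, 0) = -1)
    (h00 : ∀ x y, (x.1 = y.1 → x.2 = y.2) → B x y = 0) (σ : Equiv.Perm (Fin n × Fin 2)) :
    0 ≤ Equiv.Perm.sign σ • ∏ i, B (σ (i, 0)) (σ (i, 1)) := by
  by_cases h : ∏ i, B (σ (i, 0)) (σ (i, 1)) = 0
  · rw [h, smul_zero]
  have hne : ∀ i, (σ (i, 0)).1 = (σ (i, 1)).1 ∧ (σ (i, 0)).2 ≠ (σ (i, 1)).2 := by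
    intro i
    by_contra hi
    exact h (Finset.prod_eq_zero (Finset.mem_univ i) (h00 _ _ (by tauto)))
  -- `σ` permutes the pairs by `τ` and permutes the members of each pair by `ε`
  let ε : Fin n → Equiv.Perm (Fin 2) := fun i => if (σ (i, 0)).2 = 0 then 1 else Equiv.swap 0 1
  have hfl : ∀ i, (σ (i, 0)).2 = ε i 0 ∧ (σ (i, 1)).2 = ε i 1 := by
    intro i
    have h2 := (hne i).2
    by_cases h0 : (σ (i, 0)).2 = 0
    · simp only [ε, if_pos h0, h0]
      rw [h0] at h2
      exact ⟨rfl, by simp; omega⟩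
    · simp only [ε, if_neg h0]
      exact ⟨by simp; omega, by simp; omega⟩
  have hval : ∀ i b, σ (i, b) = ((σ (i, 0)).1, ε i b) := by
    intro i b
    fin_cases b
    · exact Prod.ext rfl (hfl i).1
    · exact Prod.ext (hne i).1.symm (hfl i).2
  have hinj : Function.Injective fun i => (σ (i, 0)).1 := by
    intro i j hij
    have e : σ (i, (ε i).symm 0) = σ (j, (ε j).symm 0) := by
      rw [hval, hval j]
      simp [show (σ (i, 0)).1 = (σ (j, 0)).1 from hij]
    exact congrArg Prod.fst (σ.injective e)
  let τ : Equiv.Perm (Fin n) := Equiv.ofBijective _ (Finite.injective_iff_bijective.1 hinj)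
  have hσ : σ = Equiv.prodCongrLeft (fun _ : Fin 2 => τ) * Equiv.prodCongrRight ε := by
    ext1 ⟨i, b⟩
    rw [hval]
    rfl
  have hsign : Equiv.Perm.sign σ = ∏ i, Equiv.Perm.sign (ε i) := by
    rw [hσ, Equiv.Perm.sign_mul, Equiv.Perm.sign_prodCongrLeft, Equiv.Perm.sign_prodCongrRight,
      Fin.prod_univ_two, Int.units_mul_self, one_mul]
  have hB : ∀ i, B (σ (i, 0)) (σ (i, 1)) = ((Equiv.Perm.sign (ε i) : ℤˣ) : ℤ) := by
    intro i
    rw [hval, hval i 1]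
    by_cases h0 : (σ (i, 0)).2 = 0
    · simp [ε, h0, h01]
    · simp [ε, h0, h10]
  have hBp : ∏ i, B (σ (i, 0)) (σ (i, 1)) = ((Equiv.Perm.sign σ : ℤˣ) : ℤ) := by
    rw [hsign, Finset.prod_congr rfl fun i _ => hB i]
    push_cast
    rfl
  rw [hBp, Units.smul_def, zsmul_eq_mul, ← Int.cast_mul, Int.units_coe_mul_self]
  norm_num

theorem sum_sign_smul_prod_standard_pos {n : ℕ} {B : Fin n × Fin 2 → Fin n × Fin 2 → ℝ}
    (h01 : ∀ i, B (i, 0) (i, 1) = 1) (h10 : ∀ i, B (i, 1) (i, 0) = -1)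
    (h00 : ∀ x y, (x.1 = y.1 → x.2 = y.2) → B x y = 0) :
    0 < ∑ σ : Equiv.Perm (Fin n × Fin 2),
      Equiv.Perm.sign σ • ∏ i, B (σ (i, 0)) (σ (i, 1)) := by
  refine Finset.sum_pos' (fun σ _ => sign_smul_prod_standard_nonneg h01 h10 h00 σ)
    ⟨1, Finset.mem_univ _, ?_⟩
  simp [h01]

end Wedge

section Lie

variable {A L : Type*} [CommRing A] [LieRing L] [Module A L] [LieRingModule L A]
  [LieRinehartRing A L]

theorem lie_prod {ι : Type*} [Fintype ι] [DecidableEq ι] (X : L) (f : ι → A) :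
    ⁅X, ∏ i, f i⁆ = ∑ i, ∏ j, Function.update f i ⁅X, f i⁆ j := by
  have key : ∀ s : Finset ι, ⁅X, ∏ i ∈ s, f i⁆ =
      ∑ i ∈ s, ∏ j ∈ s, Function.update f i ⁅X, f i⁆ j := by
    intro s
    induction s using Finset.induction_on with
    | empty =>
      have h := LieRinehartRing.leibniz_mul_right X (1 : A) (1 : A)
      simp only [mul_one, smul_eq_mul, one_mul] at h
      simpa using h
    | insert a s ha ih =>
      rw [Finset.prod_insert ha, LieRinehartRing.leibniz_mul_right, ih, Finset.sum_insert ha,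
        Finset.prod_insert ha, Function.update_self]
      have h1 : ∏ j ∈ s, Function.update f a ⁅X, f a⁆ j = ∏ j ∈ s, f j :=
        Finset.prod_congr rfl fun j hj => Function.update_of_ne (ne_of_mem_of_not_mem hj ha) _ _
      have h2 : ∀ i ∈ s, ∏ j ∈ insert a s, Function.update f i ⁅X, f i⁆ j =
          f a * ∏ j ∈ s, Function.update f i ⁅X, f i⁆ j := fun i hi => by
        rw [Finset.prod_insert ha, Function.update_of_ne (ne_of_mem_of_not_mem hi ha).symm]
      rw [h1, Finset.sum_congr rfl h2, ← Finset.mul_sum, smul_eq_mul]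
      ring
  exact key Finset.univ

theorem lie_pfaffianSum {η : Cochain A L 2} {X : L} (hη : ∀ w, lieDeriv X η w = 0) {n : ℕ}
    (v : Fin n × Fin 2 → L) :
    ⁅X, pfaffianSum η v⁆ = ∑ s, pfaffianSum η (Function.update v s ⁅X, v s⁆) := by
  unfold pfaffianSum
  rw [lie_sum, Finset.sum_comm]
  refine Finset.sum_congr rfl fun σ _ => ?_
  rw [Units.smul_def, lie_zsmul, lie_prod, ← Finset.smul_sum, ← Equiv.sum_comp σ,
    Fintype.sum_prod_type]
  congr 1
  refine Finset.sum_congr rfl fun i _ => ?_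
  have h1 : ∀ b, ∏ j, (η fun c => Function.update v (σ (i, b)) ⁅X, v (σ (i, b))⁆ (σ (j, c))) =
      (η (Function.update (fun c => v (σ (i, c))) b ⁅X, v (σ (i, b))⁆)) *
        ∏ j ∈ Finset.univ.erase i, η fun c => v (σ (j, c)) := by
    intro b
    rw [← Finset.mul_prod_erase _ _ (Finset.mem_univ i)]
    congr 1
    · congr 1
      funext c
      simp [Function.update_apply]
    · refine Finset.prod_congr rfl fun j hj => ?_
      have hj := Finset.ne_of_mem_erase hj
      congr 1
      funext c
      simp [hj]
  rw [Finset.sum_congr rfl fun b _ => h1 b, ← Finset.sum_mul, ← sub_eq_zero.1 (hη _),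
    ← Finset.mul_prod_erase _ _ (Finset.mem_univ i), Function.update_self]
  congr 1
  exact Finset.prod_congr rfl fun j hj => Function.update_of_ne (Finset.ne_of_mem_erase hj) _ _

variable [Algebra ℝ A]

/-- A vector field that preserves a 2-cochain preserves its wedge powers. -/
theorem lieDeriv_wedgePow {η : Cochain A L 2} {X : L} (hη : ∀ w, lieDeriv X η w = 0) (n : ℕ)
    (v : Fin (2 * n) → L) : lieDeriv X (wedgePow η n) v = 0 := by
  obtain ⟨c, hc, d, -, e, he⟩ := exists_smul_wedgePow_eq η n
  have h : c • lieDeriv X (wedgePow η n) v = 0 := by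
    rw [lieDeriv, smul_sub, ← lie_nsmul, he, lie_nsmul, lie_pfaffianSum hη, Finset.smul_sum,
      Finset.smul_sum, ← e.sum_comp, sub_eq_zero]
    refine Finset.sum_congr rfl fun s _ => ?_
    rw [he]
    congr 2
    exact (Function.update_comp_eq_of_injective v e.injective s _).symm
  have hc' : (c : ℝ) ≠ 0 := Nat.cast_ne_zero.2 hc
  rw [← Nat.cast_smul_eq_nsmul ℝ] at h
  exact (smul_eq_zero_iff_right hc').1 h

end Lie

end LieRinehartAlgebra

/-! ### Finitely many functions whose Hamiltonian fields span -/

namespace PoissonStructure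

section Separation

variable {m : ℕ} {M : Type*} [TopologicalSpace M] [ChartedSpace (EuclideanSpace ℝ (Fin m)) M]

theorem bracket_skew_apply (π : PoissonStructure m M) (f g : SmoothFun m M) (p : M) :
    π.bracket f g p = -π.bracket g f p := by
  rw [π.bracket_skew]; rfl

theorem sum_apply {ι : Type*} (s : Finset ι) (f : ι → SmoothFun m M) (p : M) :
    (∑ i ∈ s, f i) p = ∑ i ∈ s, f i p :=
  map_sum (ContMDiffMap.evalRingHom p : SmoothFun m M →+* ℝ) f s

theorem field_sum_apply {ι : Type*} (s : Finset ι) (X : ι → SmoothField m M) (f : SmoothFun m M) :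
    (∑ i ∈ s, X i) f = ∑ i ∈ s, X i f := by
  rw [← Derivation.coeFnAddMonoidHom_apply, map_sum, Finset.sum_apply]
  rfl

/-- A family of functions separates the characteristic space at `p` if a vector `X_g(p)` of this
space vanishes as soon as it annihilates all functions of the family. -/
def Separates (π : PoissonStructure m M) {ι : Type*} (F : ι → SmoothFun m M) (p : M) : Prop :=
  ∀ g, (∀ i, π.bracket g (F i) p = 0) → ∀ u, π.bracket g u p = 0

/-- Evaluation at a point of an expansion `δ X_g = ∑ cⱼ X_{yⱼ}`. -/
theorem mul_bracket_eq_sum {π : PoissonStructure m M} {k : ℕ} {y c : Fin k → SmoothFun m M}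
    {δ g : SmoothFun m M} (h : δ • π.ham g = ∑ j, c j • π.ham (y j)) (u : SmoothFun m M) (q : M) :
    δ q * π.bracket g u q = ∑ j, c j q * π.bracket (y j) u q := by
  have h1 := congrArg (fun X : SmoothField m M => X u q) h
  simp only [field_sum_apply, sum_apply] at h1
  exact h1

theorem exists_separates_nhds (π : PoissonStructure m M) {k : ℕ} (h : π.IsRegular k) (p : M) :
    ∃ y : Fin k → SmoothFun m M, ∀ᶠ q in nhds p, π.Separates y q := by
  obtain ⟨y, δ, hδ, hy⟩ := π.exists_frame h p
  refine ⟨y, (δ.contMDiff.continuous.continuousAt.eventually_ne hδ).mono fun q hq g hg u => ?_⟩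
  obtain ⟨c, hc⟩ := hy _ (π.isTangent_ham u)
  have h1 := mul_bracket_eq_sum hc g q
  rw [Finset.sum_eq_zero fun j _ => by rw [bracket_skew_apply, hg, neg_zero, mul_zero]] at h1
  rw [bracket_skew_apply, (mul_eq_zero.1 h1).resolve_left hq, neg_zero]

theorem exists_finset_separates (π : PoissonStructure m M) {k : ℕ} (h : π.IsRegular k) {K : Set M}
    (hK : IsCompact K) : ∃ S : Finset (SmoothFun m M), ∀ q ∈ K,
      π.Separates (Subtype.val : S → SmoothFun m M) q := by
  classical
  refine hK.induction_on ⟨∅, by simp⟩ ?_ ?_ fun x hx => ?_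
  · rintro s t hst ⟨S, hS⟩
    exact ⟨S, fun q hq => hS q (hst hq)⟩
  · rintro s t ⟨S, hS⟩ ⟨T, hT⟩
    refine ⟨S ∪ T, fun q hq g hg => ?_⟩
    rcases hq with hq | hq
    · exact hS q hq g fun i => hg ⟨i, Finset.mem_union_left _ i.2⟩
    · exact hT q hq g fun i => hg ⟨i, Finset.mem_union_right _ i.2⟩
  · obtain ⟨y, hy⟩ := π.exists_separates_nhds h x
    refine ⟨_, mem_nhdsWithin_of_mem_nhds hy, Finset.univ.image y, fun q hq g hg => ?_⟩
    exact hq g fun i => hg ⟨y i, Finset.mem_image_of_mem _ (Finset.mem_univ i)⟩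

variable [IsManifold (𝓡 m) ∞ M]

/-- The values that Hamiltonian vectors take on `N` functions form a subset of `ℝᴺ` of dimension at
most `m + k`, since Hamiltonian vectors are locally parametrized by a point of `M` and `k`
coefficients with respect to a frame. -/
theorem dimH_values_le [SecondCountableTopology M] (π : PoissonStructure m M) {k : ℕ}
    (h : π.IsRegular k) {N : ℕ} (F : Fin N → SmoothFun m M) :
    dimH {w : Fin N → ℝ | ∃ (q : M) (g : SmoothFun m M), ∀ i, w i = π.bracket g (F i) q} ≤
      (m + k : ℕ) := by
  have hloc : ∀ p : M, ∃ W ∈ nhds p, dimH {w : Fin N → ℝ | ∃ q ∈ W, ∃ g : SmoothFun m M,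
      ∀ i, w i = π.bracket g (F i) q} ≤ (m + k : ℕ) := by
    intro p
    obtain ⟨y, δ, hδ, hy⟩ := π.exists_frame h p
    obtain ⟨r, hr, hball⟩ := Metric.mem_nhds_iff.1 (extChartAt_target_mem_nhds (I := 𝓡 m) p)
    let φ := extChartAt (𝓡 m) p
    let B := Metric.ball (φ p) r
    refine ⟨{q | δ q ≠ 0} ∩ (φ.source ∩ φ ⁻¹' B), Filter.inter_mem
      (δ.contMDiff.continuous.continuousAt.eventually_ne hδ) (Filter.inter_mem
        (extChartAt_source_mem_nhds p)
        ((continuousAt_extChartAt p).preimage_mem_nhds (Metric.ball_mem_nhds _ hr))), ?_⟩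
    let Ψ : EuclideanSpace ℝ (Fin m) × (Fin k → ℝ) → Fin N → ℝ := fun z i =>
      ∑ j, z.2 j * π.bracket (y j) (F i) (φ.symm z.1)
    have hΨ : ContDiffOn ℝ 1 Ψ (B ×ˢ Set.univ) := by
      refine contDiffOn_pi.2 fun i => ContDiffOn.sum fun j _ => ?_
      refine ContDiffOn.mul (ContDiff.contDiffOn (by fun_prop)) ?_
      have h1 : ContDiffOn ℝ ∞ (fun x => π.bracket (y j) (F i) (φ.symm x)) φ.target :=
        ((π.bracket (y j) (F i)).contMDiff.comp_contMDiffOn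
          (contMDiffOn_extChartAt_symm (n := ∞) p)).contDiffOn
      exact (h1.of_le (by exact_mod_cast le_top)).comp contDiff_fst.contDiffOn
        fun z hz => hball hz.1
    have hsub : {w : Fin N → ℝ | ∃ q ∈ {q | δ q ≠ 0} ∩ (φ.source ∩ φ ⁻¹' B),
        ∃ g : SmoothFun m M, ∀ i, w i = π.bracket g (F i) q} ⊆ Ψ '' (B ×ˢ Set.univ) := by
      rintro w ⟨q, ⟨hq, hqs, hqB⟩, g, hg⟩
      obtain ⟨c, hc⟩ := hy _ (π.isTangent_ham g)
      refine ⟨(φ q, fun j => (δ q)⁻¹ * c j q), ⟨hqB, trivial⟩, funext fun i => ?_⟩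
      have h1 := mul_bracket_eq_sum hc (F i) q
      simp only [Ψ]
      rw [φ.left_inv hqs, hg i, eq_comm, ← mul_right_inj' (show δ q ≠ 0 from hq), h1,
        Finset.mul_sum]
      refine Finset.sum_congr rfl fun j _ => ?_
      have : δ q ≠ 0 := hq
      field_simp
    refine (dimH_mono hsub).trans ((hΨ.dimH_image_le
      ((convex_ball _ _).prod convex_univ) subset_rfl).trans
      ((dimH_mono (Set.subset_univ _)).trans ?_))
    rw [Real.dimH_univ_eq_finrank]
    simp
  choose W hW hdim using hloc
  obtain ⟨s, hs, hcov⟩ := TopologicalSpace.countable_cover_nhds hW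
  have hsub : {w : Fin N → ℝ | ∃ (q : M) (g : SmoothFun m M), ∀ i, w i = π.bracket g (F i) q} ⊆
      ⋃ p ∈ s, {w : Fin N → ℝ | ∃ q ∈ W p, ∃ g : SmoothFun m M,
        ∀ i, w i = π.bracket g (F i) q} := by
    rintro w ⟨q, g, hg⟩
    have hq : q ∈ ⋃ p ∈ s, W p := by rw [hcov]; trivial
    simp only [Set.mem_iUnion] at hq ⊢
    obtain ⟨p, hp, hqp⟩ := hq
    exact ⟨p, hp, q, hqp, g, hg⟩
  refine (dimH_mono hsub).trans ?_
  rw [dimH_bUnion hs]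
  exact iSup₂_le fun p _ => hdim p

/-- A generic projection: out of more than `m + k` separating functions one can be dropped, after
subtraction of multiples of it from the other ones. -/
theorem exists_separates_drop [SecondCountableTopology M] (π : PoissonStructure m M) {k : ℕ}
    (h : π.IsRegular k) {N : ℕ} (hN : m + k < N) {s : Set M} (F : Fin (N + 1) → SmoothFun m M)
    (hF : ∀ q ∈ s, π.Separates F q) :
    ∃ G : Fin N → SmoothFun m M, ∀ q ∈ s, π.Separates G q := by
  have hdim : dimH {w : Fin N → ℝ | ∃ (q : M) (g : SmoothFun m M),
      ∀ i, w i = π.bracket g (F i.castSucc) q} < Module.finrank ℝ (Fin N → ℝ) := by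
    refine (π.dimH_values_le h fun i => F i.castSucc).trans_lt ?_
    rw [Module.finrank_fin_fun]
    exact_mod_cast hN
  obtain ⟨t, ht⟩ := (dense_compl_of_dimH_lt_finrank hdim).nonempty
  refine ⟨fun i => F i.castSucc - t i • F (Fin.last N), fun q hq g hg => ?_⟩
  have hg' : ∀ i : Fin N, π.bracket g (F i.castSucc) q = t i * π.bracket g (F (Fin.last N)) q := by
    intro i
    have h1 := hg i
    rw [map_sub, map_smul] at h1
    exact sub_eq_zero.1 h1
  by_cases h0 : π.bracket g (F (Fin.last N)) q = 0
  · refine hF q hq g fun i => Fin.lastCases h0 (fun i => ?_) i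
    rw [hg', h0, mul_zero]
  -- otherwise `g`, normalized on the last function, has values `t` on the others
  · refine absurd ⟨q, (π.bracket g (F (Fin.last N)) q)⁻¹ • g, fun i => ?_⟩ ht
    rw [map_smul]
    change t i = (π.bracket g (F (Fin.last N)) q)⁻¹ * π.bracket g (F i.castSucc) q
    rw [hg']
    field_simp

/-- On a compact set `m + k + 1` functions suffice. It matters that this number does not depend on
the compact set. -/
theorem exists_separates_compact [SecondCountableTopology M] (π : PoissonStructure m M) {k : ℕ}
    (h : π.IsRegular k) {K : Set M} (hK : IsCompact K) :
    ∃ F : Fin (m + k + 1) → SmoothFun m M, ∀ q ∈ K, π.Separates F q := by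
  have hred : ∀ (N : ℕ) (F : Fin (m + k + 1 + N) → SmoothFun m M),
      (∀ q ∈ K, π.Separates F q) →
      ∃ G : Fin (m + k + 1) → SmoothFun m M, ∀ q ∈ K, π.Separates G q := by
    intro N
    induction N with
    | zero => exact fun F hF => ⟨F, hF⟩
    | succ N ih =>
      intro F hF
      obtain ⟨G, hG⟩ := π.exists_separates_drop h (N := m + k + 1 + N) (by omega) F hF
      exact ih G hG
  obtain ⟨S, hS⟩ := π.exists_finset_separates h hK
  refine hred S.card (Fin.append (fun _ => 0) fun i => (S.equivFin.symm i : SmoothFun m M))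
    fun q hq g hg => hS q hq g fun i => ?_
  have h1 := hg (Fin.natAdd _ (S.equivFin i))
  rwa [Fin.append_right, Equiv.symm_apply_apply] at h1

variable [T2Space M] [SecondCountableTopology M]

theorem sigmaCompactSpace (m : ℕ) (M : Type*) [TopologicalSpace M]
    [ChartedSpace (EuclideanSpace ℝ (Fin m)) M] [SecondCountableTopology M] : SigmaCompactSpace M :=
  have := Manifold.locallyCompact_of_finiteDimensional (M := M) (𝓡 m)
  inferInstance

/-- Derivations of `C^∞(M)` are local. -/
theorem field_apply_eq_of_eventuallyEq (X : SmoothField m M) {f g : SmoothFun m M} {q : M}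
    (hfg : ∀ᶠ x in nhds q, f x = g x) : X f q = X g q := by
  have := sigmaCompactSpace m M
  obtain ⟨U, hUsub, hUo, hqU⟩ := eventually_nhds_iff.1 hfg
  obtain ⟨χ, h0, h1, -⟩ := exists_contMDiffMap_zero_one_of_isClosed (n := ⊤) (𝓡 m)
    hUo.isClosed_compl (isClosed_singleton (x := q)) (Set.disjoint_singleton_right.2 fun h => h hqU)
  let χ' : SmoothFun m M := χ
  have hz : χ' * (f - g) = 0 := by
    ext x
    change χ x * (f x - g x) = 0
    by_cases hx : x ∈ U
    · rw [hUsub x hx, sub_self, mul_zero]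
    · rw [h0 hx, Pi.zero_apply, zero_mul]
  have h2 := congrArg (fun u : SmoothFun m M => u q) (X.leibniz χ' (f - g))
  rw [hz, map_zero, map_sub] at h2
  change 0 = χ q * (X f q - X g q) + (f q - g q) * X χ' q at h2
  rw [h1 rfl, hUsub q hqU, sub_self, zero_mul, add_zero, Pi.one_apply, one_mul] at h2
  exact sub_eq_zero.1 h2.symm

/-- A smooth function with compact sublevel sets. -/
theorem exists_proper (m : ℕ) (M : Type*) [TopologicalSpace M]
    [ChartedSpace (EuclideanSpace ℝ (Fin m)) M] [IsManifold (𝓡 m) ∞ M] [T2Space M]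
    [SecondCountableTopology M] :
    ∃ ρ : SmoothFun m M, ∀ a : ℝ, IsCompact {x | ρ x ≤ a} := by
  have := Manifold.locallyCompact_of_finiteDimensional (M := M) (𝓡 m)
  let K := CompactExhaustion.choice M
  obtain ⟨ρ, hρ⟩ := exists_contMDiffMap_forall_mem_convex_of_local_const (n := ⊤) (𝓡 m)
    (t := fun x : M => Set.Ici ((K.find x : ℕ) : ℝ)) (fun x => convex_Ici _) (fun x => by
      refine ⟨(K.find x + 1 : ℕ), ?_⟩
      have hx := K.subset_interior_succ _ (K.mem_find x)
      filter_upwards [isOpen_interior.mem_nhds hx] with z hz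
      have := K.mem_iff_find_le.1 (interior_subset hz)
      exact Set.mem_Ici.2 (by exact_mod_cast this))
  refine ⟨ρ, fun a => ?_⟩
  obtain ⟨n, hn⟩ := exists_nat_ge a
  refine (K.isCompact n).of_isClosed_subset (isClosed_le ρ.contMDiff.continuous continuous_const)
    fun x hx => K.mem_iff_find_le.2 ?_
  have h1 : ((K.find x : ℕ) : ℝ) ≤ ρ x := hρ x
  exact_mod_cast h1.trans (le_trans hx hn)

/-- Functions can be prescribed on neighbourhoods of every other slab `2j + r ≤ ρ ≤ 2j + r + 1`. -/
theorem exists_eq_on_slabs (ρ : SmoothFun m M) (r : ℝ) (F : ℤ → SmoothFun m M) :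
    ∃ G : SmoothFun m M, ∀ (j : ℤ) (x : M), ρ x ∈ Set.Icc (2 * j + r - 1 / 4) (2 * j + r + 5 / 4) →
      G x = F j x := by
  have := sigmaCompactSpace m M
  obtain ⟨G, hG⟩ := exists_contMDiffMap_forall_mem_convex_of_local (n := ⊤) (𝓡 m)
    (t := fun x : M => {z : ℝ | ∀ j : ℤ, ρ x ∈ Set.Icc (2 * j + r - 1 / 4 : ℝ) (2 * j + r + 5 / 4) →
      z = F j x})
    (fun x a ha b hb s t hs ht hst j hj => by
      rw [ha j hj, hb j hj, ← add_smul, hst, one_smul])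
    (fun x => by
      let j : ℤ := ⌊(ρ x - r) / 2 + 1 / 4⌋
      have h1 : (j : ℝ) ≤ (ρ x - r) / 2 + 1 / 4 := Int.floor_le _
      have h2 : (ρ x - r) / 2 + 1 / 4 < j + 1 := Int.lt_floor_add_one _
      refine ⟨ρ ⁻¹' Set.Ioo (2 * j + r - 5 / 8) (2 * j + r + 3 / 2),
        ρ.contMDiff.continuous.continuousAt.preimage_mem_nhds (Ioo_mem_nhds (by linarith)
          (by linarith)), F j, (F j).contMDiff.contMDiffOn, fun z hz i hi => ?_⟩
      have h3 : i < j + 1 := by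
        have : (i : ℝ) < (j + 1 : ℤ) := by push_cast; linarith [hz.2, hi.1]
        exact_mod_cast this
      have h4 : j < i + 1 := by
        have : (j : ℝ) < (i + 1 : ℤ) := by push_cast; linarith [hz.1, hi.2]
        exact_mod_cast this
      rw [show i = j by omega])
  exact ⟨G, fun j x hx => hG x j hx⟩

/-- On all of `M` finitely many functions separate the characteristic spaces, even if `M` is not
compact: the sublevel sets of a proper function `ρ` are compact, and the functions chosen for the
slabs `i ≤ ρ ≤ i + 1` with `i` even, and for those with `i` odd, are glued. -/
theorem exists_finite_separates (π : PoissonStructure m M) {k : ℕ} (h : π.IsRegular k) :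
    ∃ F : Fin 2 × Fin (m + k + 1) → SmoothFun m M, ∀ q, π.Separates F q := by
  obtain ⟨ρ, hρ⟩ := exists_proper m M
  have hK : ∀ (r : Fin 2) (j : ℤ), ∃ F : Fin (m + k + 1) → SmoothFun m M,
      ∀ q ∈ {x | ρ x ≤ 2 * j + (r : ℕ) + 1}, π.Separates F q := fun r j =>
    π.exists_separates_compact h (hρ _)
  choose F hF using hK
  choose G hG using fun (r : Fin 2) (i : Fin (m + k + 1)) =>
    exists_eq_on_slabs ρ (r : ℕ) fun j => F r j i
  refine ⟨fun x => G x.1 x.2, fun q g hg => ?_⟩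
  obtain ⟨r, j, h1, h2⟩ : ∃ (r : Fin 2) (j : ℤ), (2 * j + (r : ℕ) : ℝ) ≤ ρ q ∧
      ρ q ≤ 2 * j + (r : ℕ) + 1 := by
    have hl := Int.floor_le (ρ q)
    have hu := (Int.lt_floor_add_one (ρ q)).le
    obtain ⟨i, hi | hi⟩ := Int.even_or_odd' ⌊ρ q⌋
    · rw [hi] at hl hu
      push_cast at hl hu
      exact ⟨0, i, by simpa using hl, by simpa using hu⟩
    · rw [hi] at hl hu
      push_cast at hl hu
      exact ⟨1, i, by simpa using hl, by simpa using hu⟩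
  refine hF r j q h2 g fun i => ?_
  rw [← hg (r, i)]
  refine field_apply_eq_of_eventuallyEq (π.ham g) ?_
  have hnear : ∀ᶠ x in nhds q, ρ x ∈ Set.Icc (2 * j + (r : ℕ) - 1 / 4 : ℝ)
      (2 * j + (r : ℕ) + 5 / 4) :=
    ρ.contMDiff.continuous.continuousAt.preimage_mem_nhds
      (Icc_mem_nhds (by linarith) (by linarith))
  exact hnear.mono fun x hx => (hG r i j x hx).symm

end Separation
end PoissonStructure

/-! ### Frames of Hamiltonian fields -/

namespace PoissonStructure

open LieRinehartAlgebra

section Frames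

variable {m : ℕ} {M : Type*} [TopologicalSpace M] [ChartedSpace (EuclideanSpace ℝ (Fin m)) M]

/-- The Poisson bracket at a point, as a bilinear form on functions. -/
noncomputable def bracketAt (π : PoissonStructure m M) (p : M) :
    SmoothFun m M →ₗ[ℝ] SmoothFun m M →ₗ[ℝ] ℝ :=
  π.bracket.compr₂
    { toFun := fun f => f p
      map_add' := fun _ _ => rfl
      map_smul' := fun _ _ => rfl }

theorem bracketAt_apply (π : PoissonStructure m M) (p : M) (f g : SmoothFun m M) :
    π.bracketAt p f g = π.bracket f g p := rfl

/-- The Hamiltonian vector field of `f`, as a leafwise vector field. -/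
noncomputable def leafwiseHam (π : PoissonStructure m M) {k : ℕ} (h : π.IsRegular k)
    (f : SmoothFun m M) : π.leafwiseFields h :=
  ⟨π.ham f, π.isTangent_ham f⟩

theorem leafwiseHam_lie (π : PoissonStructure m M) {k : ℕ} (h : π.IsRegular k)
    (f g : SmoothFun m M) : ⁅π.leafwiseHam h f, g⁆ = π.bracket f g := rfl

theorem lie_leafwiseHam (π : PoissonStructure m M) {k : ℕ} (h : π.IsRegular k)
    (f g : SmoothFun m M) :
    ⁅π.leafwiseHam h f, π.leafwiseHam h g⁆ = π.leafwiseHam h (π.bracket f g) :=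
  Subtype.ext (π.lie_ham f g)

/-- The family `y` is a frame of the characteristic foliation near `p`: with a denominator `δ` that
does not vanish at `p`, all leafwise fields are combinations of the Hamiltonian fields of `y`. -/
def IsFrameAt (π : PoissonStructure m M) {k : ℕ} (h : π.IsRegular k) (y : Fin k → SmoothFun m M)
    (δ : SmoothFun m M) (p : M) : Prop :=
  δ p ≠ 0 ∧ ∀ X : π.leafwiseFields h, ∃ c : Fin k → SmoothFun m M,
    δ • X = ∑ j, c j • π.leafwiseHam h (y j)

variable {π : PoissonStructure m M} {k : ℕ} {h : π.IsRegular k}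

theorem leafwise_sum_coe {ι : Type*} (s : Finset ι) (X : ι → π.leafwiseFields h) :
    ((∑ i ∈ s, X i : π.leafwiseFields h) : SmoothField m M) = ∑ i ∈ s, (X i : SmoothField m M) :=
  map_sum (π.leafwiseFields h).toSubmodule.subtype X s

theorem exists_isFrameAt (h : π.IsRegular k) (p : M) : ∃ y δ, π.IsFrameAt h y δ p := by
  obtain ⟨y, δ, hδ, hy⟩ := π.exists_frame h p
  refine ⟨y, δ, hδ, fun X => ?_⟩
  obtain ⟨c, hc⟩ := hy X X.2
  refine ⟨c, Subtype.ext ?_⟩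
  rw [leafwise_sum_coe]
  exact hc

/-- Constants are written as functions, since leafwise fields are used as a `C^∞(M)`-module. -/
theorem leafwiseHam_sum_smul {ι : Type*} [Fintype ι] (a : ι → ℝ) (F : ι → SmoothFun m M) :
    π.leafwiseHam h (∑ i, a i • F i) =
      ∑ i, algebraMap ℝ (SmoothFun m M) (a i) • π.leafwiseHam h (F i) := by
  refine Subtype.ext (Derivation.ext fun u => ?_)
  rw [leafwise_sum_coe, field_sum_apply]
  change π.bracket (∑ i, a i • F i) u = ∑ i, algebraMap ℝ (SmoothFun m M) (a i) * π.bracket (F i) u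
  rw [map_sum, LinearMap.sum_apply]
  refine Finset.sum_congr rfl fun i _ => ?_
  rw [map_smul, LinearMap.smul_apply, Algebra.smul_def]

theorem IsFrameAt.mul_bracket {y : Fin k → SmoothFun m M} {δ g : SmoothFun m M}
    {c : Fin k → SmoothFun m M}
    (hc : δ • π.leafwiseHam h g = ∑ j, c j • π.leafwiseHam h (y j)) (u : SmoothFun m M) (q : M) :
    δ q * π.bracket g u q = ∑ j, c j q * π.bracket (y j) u q := by
  refine mul_bracket_eq_sum ?_ u q
  have h1 := congrArg (fun X : π.leafwiseFields h => (X : SmoothField m M)) hc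
  simp only [leafwise_sum_coe] at h1
  exact h1

/-- The Hamiltonian vectors of a frame are linearly independent, because there are as many of them
as the dimension of the characteristic space. -/
theorem IsFrameAt.eq_zero_of_sum {y : Fin k → SmoothFun m M} {δ : SmoothFun m M} {p : M}
    (hy : π.IsFrameAt h y δ p) {a : Fin k → ℝ}
    (ha : ∀ u, ∑ j, a j * π.bracket (y j) u p = 0) : a = 0 := by
  let v : Fin k → π.charSpace p := fun j => ⟨Derivation.evalAt p (π.ham (y j)), y j, rfl⟩
  have hv : ∀ (b : Fin k → ℝ) (u : SmoothFun m M),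
      ((∑ j, b j • v j : π.charSpace p) : PointDerivation (𝓡 m) p) u =
        ∑ j, b j * π.bracket (y j) u p := by
    intro b u
    let E : π.charSpace p →ₗ[ℝ] ℝ :=
      { toFun := fun w => (w : PointDerivation (𝓡 m) p) u
        map_add' := fun _ _ => rfl
        map_smul' := fun _ _ => rfl }
    change E _ = _
    rw [map_sum]
    exact Finset.sum_congr rfl fun j _ => by rw [map_smul]; rfl
  have hspan : ⊤ ≤ Submodule.span ℝ (Set.range v) := by
    rintro ⟨w, g, rfl⟩ -
    obtain ⟨c, hc⟩ := hy.2 (π.leafwiseHam h g)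
    refine (Submodule.mem_span_range_iff_exists_fun ℝ).2 ⟨fun j => (δ p)⁻¹ * c j p, ?_⟩
    refine Subtype.ext (Derivation.ext fun u => ?_)
    refine (hv _ u).trans ?_
    change _ = π.bracket g u p
    have h1 := IsFrameAt.mul_bracket hc u p
    rw [eq_comm, ← mul_right_inj' hy.1, h1, Finset.mul_sum]
    refine Finset.sum_congr rfl fun j _ => ?_
    have := hy.1
    field_simp
  have hli : LinearIndependent ℝ v := linearIndependent_of_top_le_span_of_card_eq_finrank hspan
    (by rw [Fintype.card_fin, Module.finrank_eq_of_rank_eq (h p)])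
  refine funext (Fintype.linearIndependent_iff.1 hli a ?_)
  exact Subtype.ext (Derivation.ext fun u => (hv a u).trans (ha u))

/-- A separating family contains a frame near every point, up to linear combinations with constant
coefficients. -/
theorem Separates.exists_isFrameAt {ι : Type*} [Fintype ι] (h : π.IsRegular k)
    {F : ι → SmoothFun m M} {p : M} (hF : π.Separates F p) :
    ∃ (a : Fin k → ι → ℝ) (δ : SmoothFun m M),
      π.IsFrameAt h (fun j => ∑ i, a j i • F i) δ p := by
  obtain ⟨y, δ, hy⟩ := PoissonStructure.exists_isFrameAt h p
  -- as functionals on Hamiltonian vectors at `p`, the `y j` are combinations of the family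
  have hspan : ∀ j, ∃ a : ι → ℝ, ∀ u, π.bracket (∑ i, a i • F i) u p = π.bracket (y j) u p := by
    intro j
    have h1 : (π.bracketAt p).flip (y j) ∈
        Submodule.span ℝ (Set.range fun i => (π.bracketAt p).flip (F i)) := by
      refine mem_span_of_iInf_ker_le_ker fun g hg => ?_
      rw [Submodule.mem_iInf] at hg
      exact hF g hg (y j)
    obtain ⟨a, ha⟩ := (Submodule.mem_span_range_iff_exists_fun ℝ).1 h1
    refine ⟨a, fun u => ?_⟩
    have h2 := LinearMap.congr_fun ha u
    rw [bracket_skew_apply, bracket_skew_apply _ (y j), neg_inj, ← bracketAt_apply,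
      ← bracketAt_apply, ← LinearMap.flip_apply, ← LinearMap.flip_apply (π.bracketAt p), ← h2,
      map_sum]
    simp only [map_smul]
  choose a ha using hspan
  choose c hc using fun j => hy.2 (π.leafwiseHam h (∑ i, a j i • F i))
  let C : Matrix (Fin k) (Fin k) (SmoothFun m M) := c
  -- the matrix of the new fields with respect to the frame is scalar at `p`
  have hCp : (ContMDiffMap.evalRingHom p : SmoothFun m M →+* ℝ).mapMatrix C =
      δ p • (1 : Matrix (Fin k) (Fin k) ℝ) := by
    ext j l
    rw [← sub_eq_zero]
    refine congrFun (hy.eq_zero_of_sum (a := fun l => c j l p - (δ p • (1 : Matrix _ _ ℝ)) j l)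
      fun u => ?_) l
    have h1 := IsFrameAt.mul_bracket (hc j) u p
    rw [ha] at h1
    simp only [sub_mul, Finset.sum_sub_distrib, ← h1, Matrix.smul_apply, Matrix.one_apply]
    simp
  have hdet : C.det p ≠ 0 := by
    have h1 := RingHom.map_det (ContMDiffMap.evalRingHom p : SmoothFun m M →+* ℝ) C
    rw [hCp, Matrix.det_smul, Matrix.det_one, mul_one] at h1
    rw [show C.det p = δ p ^ Fintype.card (Fin k) from h1]
    exact pow_ne_zero _ hy.1
  refine ⟨a, C.det * δ, mul_ne_zero hdet hy.1, fun X => ?_⟩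
  obtain ⟨b, hb⟩ := hy.2 X
  refine ⟨fun j => δ * Matrix.vecMul b C.adjugate j, ?_⟩
  have h1 : ∀ j, (δ * Matrix.vecMul b C.adjugate j) • π.leafwiseHam h (∑ i, a j i • F i) =
      ∑ l, (Matrix.vecMul b C.adjugate j * C j l) • π.leafwiseHam h (y l) := by
    intro j
    rw [mul_comm, mul_smul, hc, Finset.smul_sum]
    exact Finset.sum_congr rfl fun l _ => smul_smul _ _ _
  have h2 : ∀ l, ∑ j, Matrix.vecMul b C.adjugate j * C j l = C.det * b l := by
    intro l
    have : Matrix.vecMul (Matrix.vecMul b C.adjugate) C = C.det • b := by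
      rw [Matrix.vecMul_vecMul, Matrix.adjugate_mul, Matrix.vecMul_smul, Matrix.vecMul_one]
    exact congrFun this l
  rw [Finset.sum_congr rfl fun j _ => h1 j, Finset.sum_comm, mul_smul, hb, Finset.smul_sum]
  refine Finset.sum_congr rfl fun l _ => ?_
  rw [← Finset.sum_smul, h2, mul_smul]

theorem pow_mul_form {l : ℕ} (α : π.FoliatedForm h l) (δ : SmoothFun m M)
    (X : Fin l → π.leafwiseFields h) : δ ^ l * α X = α fun i => δ • X i := by
  have h1 := α.toMultilinearMap.map_smul_univ (fun _ => δ) X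
  rw [Finset.prod_const, Finset.card_univ, Fintype.card_fin] at h1
  exact h1.symm

/-- Forms that vanish on Hamiltonian fields vanish. -/
theorem form_eq_zero_of_ham {l : ℕ} {α : π.FoliatedForm h l}
    (hα : ∀ f : Fin l → SmoothFun m M, (α fun i => π.leafwiseHam h (f i)) = 0) : α = 0 := by
  ext X p
  obtain ⟨y, δ, hy⟩ := exists_isFrameAt h p
  choose c hc using fun i => hy.2 (X i)
  have h0 : restrictFamily α (fun j => π.leafwiseHam h (y j)) = 0 :=
    Module.Basis.ext_alternating (Pi.basisFun (SmoothFun m M) (Fin k)) fun v _ => by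
      rw [restrictFamily_basis]
      exact hα fun i => y (v i)
  have h1 := pow_mul_form α δ X
  simp only [hc] at h1
  rw [← restrictFamily_apply, h0] at h1
  exact (mul_eq_zero.1 (congrArg (fun u : SmoothFun m M => u p) h1 :
    δ p ^ l * α X p = 0)).resolve_left (pow_ne_zero _ hy.1)

/-- There are no nonzero leafwise forms of degree greater than the rank. -/
theorem form_eq_zero_of_rank_lt {l : ℕ} (hl : k < l) (α : π.FoliatedForm h l) : α = 0 := by
  ext X p
  obtain ⟨y, δ, hy⟩ := exists_isFrameAt h p
  choose c hc using fun i => hy.2 (X i)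
  have h1 := pow_mul_form α δ X
  simp only [hc] at h1
  rw [map_linearCombination_eq_zero hl] at h1
  exact (mul_eq_zero.1 (congrArg (fun u : SmoothFun m M => u p) h1 :
    δ p ^ l * α X p = 0)).resolve_left (pow_ne_zero _ hy.1)

/-- In top degree, a form is determined by its value on a frame. -/
theorem IsFrameAt.exists_pow_mul_eq {y : Fin k → SmoothFun m M} {δ : SmoothFun m M} {p : M}
    (hy : π.IsFrameAt h y δ p) (X : Fin k → π.leafwiseFields h) :
    ∃ d : SmoothFun m M, ∀ α : π.FoliatedForm h k,
      δ ^ k * α X = d * α fun j => π.leafwiseHam h (y j) := by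
  choose c hc using fun i => hy.2 (X i)
  refine ⟨Matrix.det c, fun α => ?_⟩
  rw [pow_mul_form, ← map_linearCombination_eq_det_mul]
  simp only [hc]

end Frames

end PoissonStructure

/-! ### The Liouville form and the exactness criterion -/

namespace PoissonStructure

open LieRinehartAlgebra

section Symplectic

variable {m : ℕ} {M : Type*} [TopologicalSpace M] [ChartedSpace (EuclideanSpace ℝ (Fin m)) M]
  {π : PoissonStructure m M} {k : ℕ} {h : π.IsRegular k}

theorem symplectic_leafwiseHam (f g : SmoothFun m M) {v : Fin 2 → π.leafwiseFields h}
    (h0 : v 0 = π.leafwiseHam h f) (h1 : v 1 = π.leafwiseHam h g) :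
    π.leafwiseSymplectic h v = π.bracket f g := by
  rw [← π.leafwiseSymplectic_ham h f g]
  congr 1
  funext i
  fin_cases i
  · exact h0
  · exact h1

/-- Hamiltonian fields preserve the leafwise symplectic form. On Hamiltonian fields this is the
Jacobi identity. -/
theorem lieDeriv_leafwiseSymplectic (f : SmoothFun m M) (w : Fin 2 → π.leafwiseFields h) :
    lieDeriv (π.leafwiseHam h f) (π.leafwiseSymplectic h) w = 0 := by
  let X := π.leafwiseHam h f
  -- by Cartan's formula the Lie derivative is a form
  let Λ : π.FoliatedForm h 2 :=
    dForm 1 ((π.leafwiseSymplectic h).curryLeft X) + (dForm 2 (π.leafwiseSymplectic h)).curryLeft X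
  have hΛ : ∀ w, Λ w = lieDeriv X (π.leafwiseSymplectic h) w := fun w =>
    dForm_curryLeft_add (π.leafwiseSymplectic h) X w
  have h0 : Λ = 0 := by
    refine form_eq_zero_of_ham fun g => ?_
    rw [hΛ, lieDeriv, Fin.sum_univ_two, symplectic_leafwiseHam (g 0) (g 1) rfl rfl,
      symplectic_leafwiseHam (π.bracket f (g 0)) (g 1) (by simp [X, lie_leafwiseHam]) (by simp),
      symplectic_leafwiseHam (g 0) (π.bracket f (g 1)) (by simp) (by simp [X, lie_leafwiseHam]),
      leafwiseHam_lie]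
    have hJ := π.jacobi f (g 0) (g 1)
    rw [π.bracket_skew (g 1) (π.bracket f (g 0)), π.bracket_skew (g 1) f, map_neg] at hJ
    linear_combination hJ
  rw [← hΛ, h0]
  rfl

/-- Linear Darboux theorem at `p`: there are `r` pairs of functions whose brackets at `p` are those
of a part of a symplectic basis. Pairs are added one by one: while `2r` is less than the rank, some
Hamiltonian vector annihilates all functions found so far. -/
theorem exists_standard_family {n : ℕ} (h : π.IsRegular (2 * n)) (p : M) (r : ℕ) (hr : r ≤ n) :
    ∃ f : Fin r × Fin 2 → SmoothFun m M, (∀ i, π.bracket (f (i, 0)) (f (i, 1)) p = 1) ∧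
      ∀ x y, (x.1 = y.1 → x.2 = y.2) → π.bracket (f x) (f y) p = 0 := by
  induction r with
  | zero => exact ⟨fun x => x.1.elim0, fun i => i.elim0, fun x => x.1.elim0⟩
  | succ r ih =>
    obtain ⟨f, h01, h00⟩ := ih (by omega)
    have h10 : ∀ i, π.bracket (f (i, 1)) (f (i, 0)) p = -1 := fun i => by
      rw [bracket_skew_apply, h01]
    -- `2r` functions do not separate the vectors at `p`
    have hns : ¬ π.Separates f p := by
      intro hs
      let E : π.charSpace p →ₗ[ℝ] (Fin r × Fin 2 → ℝ) :=
        { toFun := fun w x => (w : PointDerivation (𝓡 m) p) (f x)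
          map_add' := fun _ _ => rfl
          map_smul' := fun _ _ => rfl }
      have hinj : Function.Injective E := by
        rw [← LinearMap.ker_eq_bot, LinearMap.ker_eq_bot']
        rintro ⟨w, g, rfl⟩ hw
        exact Subtype.ext (Derivation.ext fun u => hs g (fun x => congrFun hw x) u)
      have h1 := LinearMap.finrank_le_finrank_of_injective hinj
      rw [Module.finrank_eq_of_rank_eq (h p), Module.finrank_fintype_fun_eq_card,
        Fintype.card_prod, Fintype.card_fin, Fintype.card_fin] at h1
      omega
    rw [Separates] at hns
    push Not at hns
    obtain ⟨g, hg, u, hu⟩ := hns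
    let b := π.bracketAt p
    have hskew : ∀ u v, b u v = -b v u := fun u v => bracket_skew_apply π u v p
    -- `u` is made orthogonal to the given family, and normalized
    let u₁ := u - ∑ i, (b u (f (i, 1)) • f (i, 0) - b u (f (i, 0)) • f (i, 1))
    have hu₁ : ∀ v, b u₁ v =
        b u v - ∑ i, (b u (f (i, 1)) * b (f (i, 0)) v - b u (f (i, 0)) * b (f (i, 1)) v) := by
      intro v
      simp [u₁]
    have horth : ∀ x, b u₁ (f x) = 0 := by
      rintro ⟨i, c⟩
      rw [hu₁, Finset.sum_eq_single i]
      · fin_cases c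
        · change b u (f (i, 0)) - (b u (f (i, 1)) * b (f (i, 0)) (f (i, 0)) -
            b u (f (i, 0)) * b (f (i, 1)) (f (i, 0))) = 0
          rw [show b (f (i, 0)) (f (i, 0)) = 0 from h00 _ _ fun _ => rfl,
            show b (f (i, 1)) (f (i, 0)) = -1 from h10 i]
          ring
        · change b u (f (i, 1)) - (b u (f (i, 1)) * b (f (i, 0)) (f (i, 1)) -
            b u (f (i, 0)) * b (f (i, 1)) (f (i, 1))) = 0
          rw [show b (f (i, 1)) (f (i, 1)) = 0 from h00 _ _ fun _ => rfl,
            show b (f (i, 0)) (f (i, 1)) = 1 from h01 i]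
          ring
      · intro j _ hj
        rw [show b (f (j, 0)) (f (i, c)) = 0 from h00 _ _ fun h => absurd h hj,
          show b (f (j, 1)) (f (i, c)) = 0 from h00 _ _ fun h => absurd h hj]
        ring
      · simp
    have hg' : ∀ x, b g (f x) = 0 := hg
    have hgu₁ : b g u₁ = b g u := by
      rw [hskew, hu₁]
      simp only [hskew _ g, hg', neg_zero, mul_zero, sub_zero, Finset.sum_const_zero, neg_neg]
    have hu' : b g u ≠ 0 := hu
    let u₂ := (b g u)⁻¹ • u₁
    have h1 : b g u₂ = 1 := by
      simp only [u₂, map_smul, hgu₁, smul_eq_mul]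
      exact inv_mul_cancel₀ hu'
    have h2 : ∀ x, b u₂ (f x) = 0 := by
      intro x
      simp only [u₂, map_smul, LinearMap.smul_apply, horth, smul_zero]
    have hself : ∀ v, b v v = 0 := fun v => by linarith [hskew v v]
    let F : Fin (r + 1) × Fin 2 → SmoothFun m M :=
      fun x => Sum.elim f ![g, u₂] ((splitLastPair r).symm x)
    have hFl : ∀ i c, F (Fin.castSucc i, c) = f (i, c) := fun i c => by
      simp [F, splitLastPair]
    have hF0 : F (Fin.last r, 0) = g := by simp [F, splitLastPair]
    have hF1 : F (Fin.last r, 1) = u₂ := by simp [F, splitLastPair]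
    refine ⟨F, fun i => ?_, ?_⟩
    · refine Fin.lastCases ?_ (fun i => ?_) i
      · rw [hF0, hF1]
        exact h1
      · rw [hFl, hFl, h01]
    · have hlast : ∀ c x, b (F (Fin.last r, c)) (f x) = 0 := by
        intro c x
        fin_cases c
        · exact (congrArg (fun v => b v (f x)) hF0).trans (hg' x)
        · exact (congrArg (fun v => b v (f x)) hF1).trans (h2 x)
      rintro ⟨i, c⟩ ⟨j, d⟩ hxy
      change b (F (i, c)) (F (j, d)) = 0
      revert hxy
      refine Fin.lastCases ?_ (fun i => ?_) i <;> refine Fin.lastCases ?_ (fun j => ?_) j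
      · intro hxy
        rw [show c = d from hxy rfl, hself]
      · intro _
        rw [hFl, hlast]
      · intro _
        rw [hskew, hFl, hlast, neg_zero]
      · intro hxy
        rw [hFl, hFl]
        exact h00 _ _ fun hij => hxy (congrArg Fin.castSucc hij)

/-- The Liouville form does not vanish anywhere. -/
theorem exists_liouville_ne_zero {n : ℕ} (h : π.IsRegular (2 * n)) (p : M) :
    ∃ v : Fin (2 * n) → π.leafwiseFields h, π.liouville h v p ≠ 0 := by
  obtain ⟨f, h01, h00⟩ := π.exists_standard_family h p n le_rfl
  obtain ⟨c, hc, d, hd, e, he⟩ := exists_smul_wedgePow_eq (π.leafwiseSymplectic h) n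
  have hpos := sum_sign_smul_prod_standard_pos (B := fun x y => π.bracket (f x) (f y) p) h01
    (fun i => by rw [bracket_skew_apply, h01]) h00
  let ev : SmoothFun m M →+* ℝ := ContMDiffMap.evalRingHom p
  have hpf : ev (pfaffianSum (π.leafwiseSymplectic h) fun x => π.leafwiseHam h (f x)) =
      ∑ σ : Equiv.Perm (Fin n × Fin 2), Equiv.Perm.sign σ •
        ∏ i, π.bracket (f (σ (i, 0))) (f (σ (i, 1))) p := by
    rw [pfaffianSum, map_sum]
    refine Finset.sum_congr rfl fun σ _ => ?_
    rw [Units.smul_def, Units.smul_def, map_zsmul, map_prod]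
    congr 1
    refine Finset.prod_congr rfl fun i _ => ?_
    rw [symplectic_leafwiseHam (f (σ (i, 0))) (f (σ (i, 1))) rfl rfl]
    rfl
  let v : Fin (2 * n) → π.leafwiseFields h := fun i => π.leafwiseHam h (f (e.symm i))
  refine ⟨v, fun hv => ?_⟩
  have hv' : ev (wedgePow (π.leafwiseSymplectic h) n v) = 0 := by
    have h1 : ((n.factorial : ℝ)⁻¹) * ev (wedgePow (π.leafwiseSymplectic h) n v) = 0 := hv
    exact (mul_eq_zero.1 h1).resolve_left (by positivity)
  have h2 := congrArg ev (he v)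
  rw [map_nsmul, map_nsmul, hv', smul_zero, show v ∘ e = fun x => π.leafwiseHam h (f x) by
    funext x; simp [v], hpf, eq_comm, smul_eq_zero_iff_right hd] at h2
  exact hpos.ne' h2

theorem lieDeriv_liouville {n : ℕ} (h : π.IsRegular (2 * n)) (f : SmoothFun m M)
    (v : Fin (2 * n) → π.leafwiseFields h) :
    lieDeriv (π.leafwiseHam h f) (π.liouville h) v = 0 := by
  have h1 : lieDeriv (π.leafwiseHam h f) (π.liouville h) v = ((n.factorial : ℝ)⁻¹) •
      lieDeriv (π.leafwiseHam h f) (wedgePow (π.leafwiseSymplectic h) n) v := by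
    rw [lieDeriv, lieDeriv, smul_sub, Finset.smul_sum, leafwiseHam_lie, leafwiseHam_lie,
      ← map_smul]
    rfl
  rw [h1, lieDeriv_wedgePow (lieDeriv_leafwiseSymplectic f), smul_zero]

end Symplectic

section Volume

variable {m : ℕ} {M : Type*} [TopologicalSpace M] [ChartedSpace (EuclideanSpace ℝ (Fin m)) M]
  {π : PoissonStructure m M} {k : ℕ} {h : π.IsRegular k}

theorem IsFrameAt.apply_ne_zero {y : Fin k → SmoothFun m M} {δ : SmoothFun m M} {p : M}
    (hy : π.IsFrameAt h y δ p) {μ : π.FoliatedForm h k} (hμ : ∃ v, μ v p ≠ 0) :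
    (μ fun j => π.leafwiseHam h (y j)) p ≠ 0 := by
  obtain ⟨v, hv⟩ := hμ
  obtain ⟨d, hd⟩ := hy.exists_pow_mul_eq v
  intro h0
  have h1 : δ p ^ k * μ v p = d p * (μ fun j => π.leafwiseHam h (y j)) p :=
    congrArg (fun u : SmoothFun m M => u p) (hd μ)
  rw [h0, mul_zero] at h1
  exact hv ((mul_eq_zero.1 h1).resolve_left (pow_ne_zero _ hy.1))

theorem smul_volume_injective {μ : π.FoliatedForm h k} (hμ : ∀ p, ∃ v, μ v p ≠ 0)
    {f : SmoothFun m M} (hf : f • μ = 0) : f = 0 := by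
  ext p
  obtain ⟨v, hv⟩ := hμ p
  have h1 : f p * μ v p = 0 :=
    congrArg (fun α : π.FoliatedForm h k => α v p) hf
  exact (mul_eq_zero.1 h1).resolve_right hv

/-- The differential of the contraction of `g μ` with a Hamiltonian field, for an invariant form
`μ` of top degree: this is the Lie derivative of `g μ`. -/
theorem foliatedD_curryLeft {j : ℕ} {h : π.IsRegular (j + 1)} {μ : π.FoliatedForm h (j + 1)}
    {f : SmoothFun m M} (hinv : ∀ v, lieDeriv (π.leafwiseHam h f) μ v = 0) (g : SmoothFun m M) :
    π.foliatedD h j (g • μ.curryLeft (π.leafwiseHam h f)) = π.bracket f g • μ := by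
  ext1 v
  have h1 := dForm_curryLeft_add (g • μ) (π.leafwiseHam h f) v
  rw [form_eq_zero_of_rank_lt (Nat.lt_succ_self _) (dForm (j + 1) (g • μ)),
    AlternatingMap.zero_apply, add_zero] at h1
  refine h1.trans ?_
  have h2 := hinv v
  simp only [lieDeriv, AlternatingMap.smul_apply, smul_eq_mul,
    LieRinehartRing.leibniz_mul_right, leafwiseHam_lie, ← Finset.mul_sum] at h2 ⊢
  linear_combination g * h2

/-- The brackets are zero if the rank is zero. -/
theorem bracketSpan_eq_bot (h : π.IsRegular 0) : π.bracketSpan = ⊥ := by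
  rw [eq_bot_iff, bracketSpan, Submodule.span_le]
  rintro _ ⟨f, g, rfl⟩
  refine (Submodule.mem_bot ℝ).2 ?_
  ext p
  obtain ⟨y, δ, hδ, hy⟩ := exists_isFrameAt h p
  obtain ⟨c, hc⟩ := hy (π.leafwiseHam h f)
  have h1 := IsFrameAt.mul_bracket hc g p
  rw [Fin.sum_univ_zero] at h1
  exact (mul_eq_zero.1 h1).resolve_left hδ

variable [IsManifold (𝓡 m) ∞ M] [T2Space M] [SecondCountableTopology M]

/-- A form of top degree is a multiple of any nowhere vanishing one. The quotient is smooth locally,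
and being unique it glues. -/
theorem exists_smul_volume_eq {μ : π.FoliatedForm h k} (hμ : ∀ p, ∃ v, μ v p ≠ 0)
    (α : π.FoliatedForm h k) : ∃ f : SmoothFun m M, f • μ = α := by
  have := sigmaCompactSpace m M
  obtain ⟨f, hf⟩ := exists_contMDiffMap_forall_mem_convex_of_local (n := ⊤) (𝓡 m)
    (t := fun q : M => {z : ℝ | ∀ v, z * μ v q = α v q})
    (fun q a ha b hb s t hs ht hst v => by
      simp only [smul_eq_mul]
      linear_combination s * ha v + t * hb v + α v q * hst)
    (fun p => by
      obtain ⟨y, δ, hy⟩ := exists_isFrameAt h p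
      let a := α fun j => π.leafwiseHam h (y j)
      let b := μ fun j => π.leafwiseHam h (y j)
      have hb : b p ≠ 0 := hy.apply_ne_zero (hμ p)
      refine ⟨{q | δ q ≠ 0} ∩ {q | b q ≠ 0}, Filter.inter_mem
        (δ.contMDiff.continuous.continuousAt.eventually_ne hy.1)
        (b.contMDiff.continuous.continuousAt.eventually_ne hb), fun q => a q / b q,
        fun q hq => ((a.contMDiff q).div₀ (b.contMDiff q) hq.2).contMDiffWithinAt, ?_⟩
      rintro q ⟨hδ, hbq⟩ v
      obtain ⟨d, hd⟩ := hy.exists_pow_mul_eq v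
      have h1 : δ q ^ k * μ v q = d q * b q := congrArg (fun u : SmoothFun m M => u q) (hd μ)
      have h2 : δ q ^ k * α v q = d q * a q := congrArg (fun u : SmoothFun m M => u q) (hd α)
      have hδ' : δ q ^ k ≠ 0 := pow_ne_zero _ hδ
      have hbq' : b q ≠ 0 := hbq
      rw [div_mul_eq_mul_div, div_eq_iff hbq', ← mul_right_inj' hδ']
      linear_combination a q * h1 - b q * h2)
  refine ⟨f, ?_⟩
  ext v q
  exact hf q v

/-- The forms of degree one less than the rank are combinations of contractions of a volume form
with the Hamiltonian fields of a separating family. -/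
theorem exists_eq_sum_curryLeft {j : ℕ} {h : π.IsRegular (j + 1)} {μ : π.FoliatedForm h (j + 1)}
    (hμ : ∀ p, ∃ v, μ v p ≠ 0) {ι : Type*} [Fintype ι] {F : ι → SmoothFun m M}
    (hF : ∀ p, π.Separates F p) (β : π.FoliatedForm h j) :
    ∃ g : ι → SmoothFun m M, β = ∑ i, g i • μ.curryLeft (π.leafwiseHam h (F i)) := by
  have := sigmaCompactSpace m M
  obtain ⟨g, hg⟩ := exists_contMDiffMap_forall_mem_convex_of_local (n := ⊤) (𝓡 m)
    (t := fun q : M => {z : ι → ℝ | ∀ w,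
      ∑ i, z i * μ.curryLeft (π.leafwiseHam h (F i)) w q = β w q})
    (fun q a ha b hb s t hs ht hst w => by
      simp only [Pi.add_apply, Pi.smul_apply, smul_eq_mul, add_mul, mul_assoc,
        Finset.sum_add_distrib, ← Finset.mul_sum]
      rw [ha w, hb w, ← add_mul, hst, one_mul])
    (fun p => by
      -- the coefficients with respect to a frame of combinations of the family, given by
      -- `mul_map_linearCombination_eq_sum`, are redistributed over the family
      obtain ⟨a, δ, hy⟩ := (hF p).exists_isFrameAt h
      let Y : Fin (j + 1) → π.leafwiseFields h := fun l => π.leafwiseHam h (∑ i, a l i • F i)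
      let b := μ Y
      have hb : b p ≠ 0 := hy.apply_ne_zero (hμ p)
      let num : ι → SmoothFun m M := fun i => ∑ l : Fin (j + 1), (-1) ^ (l : ℕ) *
        β (l.removeNth Y) * algebraMap ℝ (SmoothFun m M) (a l i)
      refine ⟨{q | δ q ≠ 0} ∩ {q | b q ≠ 0}, Filter.inter_mem
        (δ.contMDiff.continuous.continuousAt.eventually_ne hy.1)
        (b.contMDiff.continuous.continuousAt.eventually_ne hb),
        fun q i => num i q / b q,
        fun q hq => contMDiffWithinAt_pi_space.2 fun i =>
          (((num i).contMDiff q).div₀ (b.contMDiff q) hq.2).contMDiffWithinAt, ?_⟩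
      rintro q ⟨hδ, hbq⟩ w
      choose c hc using fun i => hy.2 (w i)
      have h1 := mul_map_linearCombination_eq_sum μ β Y c
      have hc' : (fun i => ∑ l, c i l • Y l) = fun i => δ • w i := funext fun i => (hc i).symm
      rw [hc'] at h1
      simp only [← pow_mul_form] at h1
      have h2 : ∀ l, μ.curryLeft (Y l) w = ∑ i, algebraMap ℝ (SmoothFun m M) (a l i) *
          μ.curryLeft (π.leafwiseHam h (F i)) w := by
        intro l
        simp only [Y]
        rw [leafwiseHam_sum_smul, map_sum, alternating_sum_apply]
        refine Finset.sum_congr rfl fun i _ => ?_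
        rw [map_smul]
        rfl
      have h3 : b * (δ ^ j * β w) =
          δ ^ j * ∑ i, num i * μ.curryLeft (π.leafwiseHam h (F i)) w := by
        refine h1.trans ?_
        simp only [h2, num, Finset.mul_sum, Finset.sum_mul]
        rw [Finset.sum_comm]
        exact Finset.sum_congr rfl fun i _ => Finset.sum_congr rfl fun l _ => by ring
      have h4 := congrArg (fun u : SmoothFun m M => u q) h3
      change b q * (δ q ^ j * β w q) =
        δ q ^ j * (∑ i, num i * μ.curryLeft (π.leafwiseHam h (F i)) w : SmoothFun m M) q at h4
      rw [sum_apply] at h4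
      change b q * (δ q ^ j * β w q) =
        δ q ^ j * ∑ i, num i q * μ.curryLeft (π.leafwiseHam h (F i)) w q at h4
      have hδ' : δ q ^ j ≠ 0 := pow_ne_zero _ hδ
      have hbq' : b q ≠ 0 := hbq
      simp only [div_mul_eq_mul_div]
      rw [← Finset.sum_div, div_eq_iff hbq', ← mul_right_inj' hδ', ← h4]
      ring)
  refine ⟨fun i => ⟨fun q => g q i, contMDiff_pi_space.1 g.contMDiff i⟩, ?_⟩
  ext w q
  rw [alternating_sum_apply, sum_apply]
  exact (hg q w).symm

/-- For an invariant volume form `μ` the functions `f` for which `f μ` is exact are the sums of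
brackets. -/
theorem smul_volume_mem_exactForms {μ : π.FoliatedForm h k} (hμ : ∀ p, ∃ v, μ v p ≠ 0)
    (hinv : ∀ f v, lieDeriv (π.leafwiseHam h f) μ v = 0) (f : SmoothFun m M) :
    f • μ ∈ π.exactForms h k ↔ f ∈ π.bracketSpan := by
  cases k with
  | zero =>
    rw [bracketSpan_eq_bot h]
    change f • μ = 0 ↔ f = 0
    exact ⟨smul_volume_injective hμ, fun hf => by rw [hf, zero_smul]⟩
  | succ j =>
    change f • μ ∈ LinearMap.range (π.foliatedD h j) ↔ _
    constructor
    · rintro ⟨β, hβ⟩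
      obtain ⟨F, hF⟩ := π.exists_finite_separates h
      obtain ⟨g, rfl⟩ := exists_eq_sum_curryLeft hμ hF β
      rw [map_sum, Finset.sum_congr rfl fun i _ => foliatedD_curryLeft (hinv (F i)) (g i),
        ← Finset.sum_smul, ← sub_eq_zero, ← sub_smul] at hβ
      rw [← sub_eq_zero.1 (smul_volume_injective hμ hβ)]
      exact Submodule.sum_mem _ fun i _ => Submodule.subset_span ⟨_, _, rfl⟩
    · intro hf
      induction hf using Submodule.span_induction with
      | mem u hu =>
        obtain ⟨f, g, rfl⟩ := hu
        exact ⟨_, foliatedD_curryLeft (hinv f) g⟩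
      | zero =>
        rw [zero_smul]
        exact Submodule.zero_mem _
      | add u v _ _ hu hv =>
        rw [add_smul]
        exact Submodule.add_mem _ hu hv
      | smul c u _ hu =>
        have e : (c • u) • μ = c • (u • μ) := by
          ext1 v
          exact smul_mul_assoc c u (μ v)
        rw [e]
        exact Submodule.smul_mem _ _ hu

end Volume

end PoissonStructure

theorem theorem1 {m : ℕ} {M : Type*} [TopologicalSpace M] [T2Space M] [SecondCountableTopology M]
    [ChartedSpace (EuclideanSpace ℝ (Fin m)) M] [IsManifold (𝓡 m) ∞ M]
    (π : PoissonStructure m M) (n : ℕ) (h : π.IsRegular (2 * n)) :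
    Submodule.map (π.toTopForm h) π.bracketSpan = π.exactForms h (2 * n) ∧
    ∃ (hclosed : ∀ f : SmoothFun m M, π.foliatedD h (2 * n) (π.toTopForm h f) = 0)
      (Φ : π.PoissonH0 ≃ₗ[ℝ] π.FoliatedCohomology h (2 * n)),
      ∀ f : SmoothFun m M,
        Φ (Submodule.Quotient.mk f) = π.foliatedClass h (π.toTopForm h f) (hclosed f) := by
  have hμ := PoissonStructure.exists_liouville_ne_zero h
  have hexact : ∀ f, π.toTopForm h f ∈ π.exactForms h (2 * n) ↔ f ∈ π.bracketSpan :=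
    PoissonStructure.smul_volume_mem_exactForms hμ (PoissonStructure.lieDeriv_liouville h)
  have hsurj : Function.Surjective (π.toTopForm h) :=
    PoissonStructure.exists_smul_volume_eq hμ
  have hclosed : ∀ f : SmoothFun m M, π.foliatedD h (2 * n) (π.toTopForm h f) = 0 := fun f =>
    PoissonStructure.form_eq_zero_of_rank_lt (Nat.lt_succ_self _) _
  refine ⟨?_, hclosed, ?_⟩
  · ext α
    constructor
    · rintro ⟨f, hf, rfl⟩
      exact (hexact f).2 hf
    · intro hα
      obtain ⟨f, rfl⟩ := hsurj α
      exact ⟨f, (hexact f).1 hα, rfl⟩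
  · let φ : SmoothFun m M →ₗ[ℝ] π.closedForms h (2 * n) :=
      (π.toTopForm h).codRestrict _ fun f => LinearMap.mem_ker.2 (hclosed f)
    let ψ : SmoothFun m M →ₗ[ℝ] π.FoliatedCohomology h (2 * n) := (Submodule.mkQ _).comp φ
    have hker : LinearMap.ker ψ = π.bracketSpan := by
      ext f
      rw [LinearMap.mem_ker, LinearMap.comp_apply, Submodule.mkQ_apply,
        Submodule.Quotient.mk_eq_zero, Submodule.mem_comap]
      exact hexact f
    have hψ : Function.Surjective ψ := by
      refine (Submodule.mkQ_surjective _).comp fun α => ?_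
      obtain ⟨f, hf⟩ := hsurj α
      exact ⟨f, Subtype.ext hf⟩
    exact ⟨(Submodule.quotEquivOfEq _ _ hker.symm).trans (ψ.quotKerEquivOfSurjective hψ),
      fun f => rfl⟩
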